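/- Let $U\subset\mathbb R$ be an open neighbourhood of $0$, let $c:U\to\mathbb R$ satisfy $c(0)=1$, and let $\varphi\in C_b^2(\mathbb R)$, $\psi\in C_b^1(\mathbb R)$, where $C_b^m(\mathbb R)$ is the space of $C^m$ functions that are bounded together with all their derivatives up to order $m$. For $\varepsilon>0$ consider the Cauchy problem $$u_{tt}-c(u_x)^2u_{xx}=0,\qquad u(0,x)=\varepsilon\varphi(x),\quad u_t(0,x)=\varepsilon\psi(x)\qquad(x\in\mathbb R),$$ and let its lifespan $T^*=T^*(\varepsilon)\in[0,\infty]$ be the supremum of all $T>0$ for which there is a classical ($C^2$) solution $u$ on $[0,T)\times\mathbb R$, with $u_x$ taking values in $U$, such that $$\sup_{t\in[0,T)}\Bigl(\|u(t)\|_{L^\infty}+\|u_t(t)\|_{L^\infty}+\|u_x(t)\|_{L^\infty}+\|u_{tt}(t)\|_{L^\infty}+\|u_{tx}(t)\|_{L^\infty}+\|u_{xx}(t)\|_{L^\infty}+\|c(u_x(t))^{-1}\|_{L^\infty}\Bigr)<\infty.$$ (a) Suppose that $p>2$ is a real number such that $c\in C^{\lceil p-2\rceil,\,p-\lceil p-1\rceil}(U)$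 (that is, $c$ is $C^{\lceil p-2\rceil}$ on $U$ and $c^{(\lceil p-2\rceil)}$ is Hölder continuous on $U$ with exponent $p-\lceil p-1\rceil\in(0,1]$), $c'(0)=\dots=c^{(\lceil p-2\rceil)}(0)=0$, and for some constant $K>0$ $$\bigl|c^{(\lceil p-2\rceil)}(\theta)\bigr|\le K|\theta|^{p-\lceil p-1\rceil}\quad\text{for all }\theta\in U.$$ Then there are constants $\varepsilon_0>0$ and $C>0$, with $C$ independent of $\varepsilon$, such that $T^*\ge C\varepsilon^{-(p-1)}$ whenever $0<\varepsilon\le\varepsilon_0$. (b) Suppose instead that $c\in C^1(U)$ and $c'(0)\neq0$. Then there are constants $\varepsilon_0>0$ and $C>0$, with $C$ independent of $\varepsilon$, such that $T^*\ge C\varepsilon^{-1}$ whenever $0<\varepsilon\le\varepsilon_0$. -/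

import Mathlib

open MeasureTheory Set
open scoped ENNReal NNReal

noncomputable section

namespace QuasilinearWave

/-- `C_b^m(ℝ)`: `m` times continuously differentiable functions that are bounded together with
all their derivatives up to order `m`. -/
def IsCb (m : ℕ) (f : ℝ → ℝ) : Prop :=
  ContDiff ℝ m f ∧ ∀ k ≤ m, ∃ B : ℝ, ∀ x, |iteratedDeriv k f x| ≤ B

/-- `C^{m,α}(U)` for an open set `U ⊆ ℝ`: `m` times continuously differentiable on `U`, with
`m`-th derivative Hölder continuous on `U` with exponent `α`. -/
def IsCHolder (m : ℕ) (α : ℝ≥0) (U : Set ℝ) (f : ℝ → ℝ) : Prop :=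
  ContDiffOn ℝ m f U ∧ ∃ K : ℝ≥0, HolderOnWith K α (iteratedDeriv m f) U

/-- The wave speed `c` is flat of order `⌈p-2⌉` at the origin, with the Hölder-type bound.
For `p > 2` the exponent `p - ⌈p-1⌉` lies in `(0, 1]` and the order `⌈p-2⌉` is at least `1`. -/
def FlatSpeed (p : ℝ) (U : Set ℝ) (c : ℝ → ℝ) : Prop :=
  IsCHolder ⌈p - 2⌉₊ (p - (⌈p - 1⌉ : ℝ)).toNNReal U c ∧
  (∀ k : ℕ, 1 ≤ k → k ≤ ⌈p - 2⌉₊ → iteratedDeriv k c 0 = 0) ∧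
  ∃ K : ℝ, 0 < K ∧ ∀ θ ∈ U, |iteratedDeriv ⌈p - 2⌉₊ c θ| ≤ K * |θ| ^ (p - (⌈p - 1⌉ : ℝ))

/-- Time derivative `u_t` of a function `u (t, x)` on `t ≥ 0` (one-sided at `t = 0`). -/
def dt (u : ℝ → ℝ → ℝ) : ℝ → ℝ → ℝ :=
  fun t x => derivWithin (fun s => u s x) (Ici 0) t

/-- Space derivative `u_x` of a function `u (t, x)`. -/
def dx (u : ℝ → ℝ → ℝ) : ℝ → ℝ → ℝ :=
  fun t x => deriv (fun y => u t y) x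

/-- `u` is a classical (`C²`) solution on `[0,T) × ℝ` of `u_tt - c(u_x)² u_xx = 0` with
`u(0,·) = u₀` and `u_t(0,·) = u₁`, where the speed `c` has domain `U`. -/
structure IsClassicalSolution (U : Set ℝ) (c u₀ u₁ : ℝ → ℝ) (T : ℝ) (u : ℝ → ℝ → ℝ) : Prop where
  contDiffOn : ContDiffOn ℝ 2 (fun q : ℝ × ℝ => u q.1 q.2) (Ico 0 T ×ˢ univ)
  mem_domain : ∀ t ∈ Ico 0 T, ∀ x, dx u t x ∈ U
  equation : ∀ t ∈ Ico 0 T, ∀ x, dt (dt u) t x - c (dx u t x) ^ 2 * dx (dx u) t x = 0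
  initial_pos : ∀ x, u 0 x = u₀ x
  initial_vel : ∀ x, dt u 0 x = u₁ x

/-- The quantity
`‖u‖ + ‖u_t‖ + ‖u_x‖ + ‖u_tt‖ + ‖u_tx‖ + ‖u_xx‖ + ‖c(u_x)⁻¹‖` at time `t`, with `L^∞(ℝ)` norms.
The inverse in the last summand is taken in `[0,∞]`, so that it is infinite where `c(u_x) = 0`. -/
def size (c : ℝ → ℝ) (u : ℝ → ℝ → ℝ) (t : ℝ) : ℝ≥0∞ :=
  eLpNorm (u t) ∞ volume + eLpNorm (dt u t) ∞ volume + eLpNorm (dx u t) ∞ volume +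
  eLpNorm (dt (dt u) t) ∞ volume + eLpNorm (dx (dt u) t) ∞ volume +
  eLpNorm (dx (dx u) t) ∞ volume +
  eLpNorm (fun x => (‖c (dx u t x)‖ₑ)⁻¹) ∞ volume

/-- The lifespan `T* ∈ [0,∞]`: the supremum of all `T > 0` such that the Cauchy problem has a
classical solution on `[0,T) × ℝ` for which `sup_{t ∈ [0,T)} size c u t` is finite. -/
def lifespan (U : Set ℝ) (c u₀ u₁ : ℝ → ℝ) : ℝ≥0∞ :=
  sSup {τ : ℝ≥0∞ | ∃ T : ℝ, 0 < T ∧ τ = ENNReal.ofReal T ∧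
    ∃ u : ℝ → ℝ → ℝ, IsClassicalSolution U c u₀ u₁ T u ∧ (⨆ t ∈ Ico 0 T, size c u t) < ∞}

end QuasilinearWave

end

/-
The Riemann invariants `u_t ± C(u_x)`, `C' = c`, are constant along the characteristics
`dx/dt = ∓ c(u_x)`, so in terms of the characteristic labels `(a, b)` of a point, which are the
positions at time `0` of the two characteristics through it, the slope `u_x` and the speed `L` are
known functions. In these coordinates the equation becomes *linear*: `x_a = L t_a` and
`x_b = -L t_b`, and the integrability conditions make `P = x_a`, `Q = x_b` solve the Goursat problem
`P_b = Q_a = (L_b P + L_a Q) / (2 L)` with `P = Q = 1/2` on the diagonal. If `|dL| ≤ κ`, a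
contraction solves it on a strip of width of order `1/κ`, where `P` and `Q` stay near `1/2`; hence
`(a, b) ↦ (t, x)` is close to a linear isomorphism and is invertible over `|t| ≲ 1/κ`. For data of
size `ε` and `c'(θ) = O(|θ|^q)` one has `κ = O(ε^(q + 1))`.
-/

namespace QuasilinearWave

open Asymptotics Filter Topology
open scoped BoundedContinuousFunction

section PlaneCalculus

/-- The linear form `α dx₁ + β dx₂` on the plane; all differentials below are written in this
form, so that their partial derivatives can be read off. -/
noncomputable def covector (α β : ℝ) : ℝ × ℝ →L[ℝ] ℝ :=
  α • ContinuousLinearMap.fst ℝ ℝ ℝ + β • ContinuousLinearMap.snd ℝ ℝ ℝ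

@[simp]
lemma covector_apply (α β : ℝ) (z : ℝ × ℝ) : covector α β z = α * z.1 + β * z.2 := rfl

lemma covector_eq (A : ℝ × ℝ →L[ℝ] ℝ) : covector (A (1, 0)) (A (0, 1)) = A := by
  ext <;> simp

lemma covector_sub (α β α' β' : ℝ) :
    covector α β - covector α' β' = covector (α - α') (β - β') := by
  ext <;> simp

lemma norm_covector_le (α β : ℝ) : ‖covector α β‖ ≤ |α| + |β| := by
  refine (norm_add_le _ _).trans (add_le_add ?_ ?_) <;> rw [norm_smul, Real.norm_eq_abs]
  · exact mul_le_of_le_one_right (abs_nonneg α) (ContinuousLinearMap.norm_fst_le ℝ ℝ ℝ)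
  · exact mul_le_of_le_one_right (abs_nonneg β) (ContinuousLinearMap.norm_snd_le ℝ ℝ ℝ)

lemma continuous_covector : Continuous fun v : ℝ × ℝ => covector v.1 v.2 := by
  unfold covector
  fun_prop

lemma hasDerivAt_slice_fst {f : ℝ × ℝ → ℝ} {α β a b : ℝ}
    (h : HasFDerivAt f (covector α β) (a, b)) : HasDerivAt (fun x => f (x, b)) α a :=
  (HasFDerivAt.comp_hasDerivAt (f := fun x => (x, b)) a h
    ((hasDerivAt_id' a).prodMk (hasDerivAt_const a b))).congr_deriv (by simp)

lemma hasDerivAt_slice_snd {f : ℝ × ℝ → ℝ} {α β a b : ℝ}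
    (h : HasFDerivAt f (covector α β) (a, b)) : HasDerivAt (fun y => f (a, y)) β b :=
  (HasFDerivAt.comp_hasDerivAt (f := fun y => (a, y)) b h
    ((hasDerivAt_const b a).prodMk (hasDerivAt_id' b))).congr_deriv (by simp)

lemma hasFDerivAt_covector_of_partials {f fa fb : ℝ × ℝ → ℝ} (hfa : Continuous fa)
    (hfb : Continuous fb) (ha : ∀ a b, HasDerivAt (fun x => f (x, b)) (fa (a, b)) a)
    (hb : ∀ a b, HasDerivAt (fun y => f (a, y)) (fb (a, b)) b) (z : ℝ × ℝ) :
    HasFDerivAt f (covector (fa z) (fb z)) z := by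
  have hspan := (ContinuousLinearMap.toSpanSingletonCLE (𝕜 := ℝ) (E := ℝ)).continuous
  have h := hasStrictFDerivAt_uncurry_coprod (𝕜 := ℝ) (u := z) (f := Function.curry f)
    (f₁ := fun a b => ContinuousLinearMap.toSpanSingleton ℝ (fa (a, b)))
    (f₂ := fun a b => ContinuousLinearMap.toSpanSingleton ℝ (fb (a, b)))
    (.of_forall fun v => (ha v.1 v.2).hasFDerivAt) (.of_forall fun v => (hb v.1 v.2).hasFDerivAt)
    (hspan.comp hfa).continuousAt (hspan.comp hfb).continuousAt
  refine HasFDerivAt.congr_fderiv (f := f) h.hasFDerivAt ?_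
  ext <;> simp [Function.HasUncurry.uncurry]

lemma contDiff_one_of_hasFDerivAt_covector {f fa fb : ℝ × ℝ → ℝ} (hfa : Continuous fa)
    (hfb : Continuous fb) (hf : ∀ z, HasFDerivAt f (covector (fa z) (fb z)) z) :
    ContDiff ℝ 1 f :=
  contDiff_one_iff_hasFDerivAt.2
    ⟨fun z => covector (fa z) (fb z), continuous_covector.comp (hfa.prodMk hfb), hf⟩

lemma continuous_intervalIntegral {X : Type*} [TopologicalSpace X] [FirstCountableTopology X]
    {f : X → ℝ → ℝ} (hf : Continuous f.uncurry) {s t : X → ℝ} (hs : Continuous s)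
    (ht : Continuous t) : Continuous fun x => ∫ y in s x..t x, f x y := by
  have hcont (x) : Continuous (f x) := hf.comp (by fun_prop : Continuous fun y => (x, y))
  have hsplit : (fun x => ∫ y in s x..t x, f x y) =
      fun x => (∫ y in (0 : ℝ)..t x, f x y) - ∫ y in (0 : ℝ)..s x, f x y := by
    ext x
    rw [intervalIntegral.integral_interval_sub_left ((hcont x).intervalIntegrable _ _)
      ((hcont x).intervalIntegrable _ _)]
  rw [hsplit]
  exact (intervalIntegral.continuous_parametric_intervalIntegral_of_continuous hf ht).sub
    (intervalIntegral.continuous_parametric_intervalIntegral_of_continuous hf hs)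

lemma hasFDerivAt_iteratedIntegral {G : ℝ × ℝ → ℝ} (hG : Continuous G) (z : ℝ × ℝ) :
    HasFDerivAt (fun z : ℝ × ℝ => ∫ x in (0 : ℝ)..z.1, ∫ y in (0 : ℝ)..z.2, G (x, y))
      (covector (∫ y in (0 : ℝ)..z.2, G (z.1, y)) (∫ x in (0 : ℝ)..z.1, G (x, z.2))) z := by
  have hcont₁ : Continuous fun z : ℝ × ℝ => ∫ y in (0 : ℝ)..z.2, G (z.1, y) :=
    continuous_intervalIntegral (f := fun (z : ℝ × ℝ) y => G (z.1, y)) (by fun_prop)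
      continuous_const continuous_snd
  have hcont₂ : Continuous fun z : ℝ × ℝ => ∫ x in (0 : ℝ)..z.1, G (x, z.2) :=
    continuous_intervalIntegral (f := fun (z : ℝ × ℝ) x => G (x, z.2)) (by fun_prop)
      continuous_const continuous_fst
  refine hasFDerivAt_covector_of_partials hcont₁ hcont₂ (fun a b => ?_) (fun a b => ?_) z
  · have hcont : Continuous fun x => ∫ y in (0 : ℝ)..b, G (x, y) :=
      hcont₁.comp (by fun_prop : Continuous fun x : ℝ => (x, b))
    exact (hcont.integral_hasStrictDerivAt 0 a).hasDerivAt
  · have hcont : Continuous fun y => ∫ x in (0 : ℝ)..a, G (x, y) :=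
      hcont₂.comp (by fun_prop : Continuous fun y : ℝ => (a, y))
    refine (hcont.integral_hasStrictDerivAt 0 b).hasDerivAt.congr_of_eventuallyEq
      (.of_forall fun b => intervalIntegral_intervalIntegral_swap ?_)
    exact (hG.continuousOn.integrableOn_compact (isCompact_uIcc.prod isCompact_uIcc)).mono_set
      (prod_mono uIoc_subset_uIcc uIoc_subset_uIcc)

lemma eq_sub_integral_add_integral_of_hasDerivAt {f g : ℝ → ℝ} (hg : Continuous g) {a b : ℝ}
    (h : ∀ y ∈ uIcc a b, HasDerivAt f (g y) y) :
    f b = (f a - ∫ y in (0 : ℝ)..a, g y) + ∫ y in (0 : ℝ)..b, g y := by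
  have hint (x y : ℝ) : IntervalIntegrable g volume x y := hg.intervalIntegrable x y
  have hdiff := intervalIntegral.integral_eq_sub_of_hasDerivAt h (hint a b)
  have hsplit := intervalIntegral.integral_add_adjacent_intervals (hint 0 a) (hint a b)
  linarith

lemma eq_on_diagonal_of_hasFDerivAt {F α β : ℝ × ℝ → ℝ} {F₀ : ℝ → ℝ}
    (hF : ∀ a, HasFDerivAt F (covector (α (a, a)) (β (a, a))) (a, a))
    (hF₀ : ∀ a, HasDerivAt F₀ (α (a, a) + β (a, a)) a) (h0 : F (0, 0) = F₀ 0) (a : ℝ) :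
    F (a, a) = F₀ a := by
  have hderiv (a : ℝ) : HasDerivAt (fun a => F (a, a) - F₀ a) 0 a := by
    have h := HasFDerivAt.comp_hasDerivAt (f := fun a => (a, a)) a (hF a) <|
      (hasDerivAt_id' a).prodMk (hasDerivAt_id' a)
    exact (h.sub (hF₀ a)).congr_deriv (by simp)
  have hconst := is_const_of_deriv_eq_zero (fun a => (hderiv a).differentiableAt)
    (fun a => (hderiv a).deriv) a 0
  rw [h0, sub_self] at hconst
  exact sub_eq_zero.1 hconst

/- Mathlib's Poincaré lemma asks for a differentiable form, whereas here only the two mixed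
partial derivatives exist; the potential is instead written down in closed form. -/
theorem exists_potential {P Q G : ℝ × ℝ → ℝ} {W : ℝ} (hW : 0 < W) (hP : Continuous P)
    (hQ : Continuous Q) (hG : Continuous G)
    (hPG : ∀ a b, |a - b| < W → HasDerivAt (fun y => P (a, y)) (G (a, b)) b)
    (hQG : ∀ a b, |a - b| < W → HasDerivAt (fun x => Q (x, b)) (G (a, b)) a)
    {F₀ : ℝ → ℝ} (hF₀ : ∀ a, HasDerivAt F₀ (P (a, a) + Q (a, a)) a) :
    ∃ F : ℝ × ℝ → ℝ, (∀ a, F (a, a) = F₀ a) ∧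
      ∀ z : ℝ × ℝ, |z.1 - z.2| < W → HasFDerivAt F (covector (P z) (Q z)) z := by
  let p (a : ℝ) : ℝ := P (a, a) - ∫ y in (0 : ℝ)..a, G (a, y)
  let q (b : ℝ) : ℝ := Q (b, b) - ∫ x in (0 : ℝ)..b, G (x, b)
  have hp : Continuous p := (hP.comp (by fun_prop : Continuous fun a : ℝ => (a, a))).sub
    (continuous_intervalIntegral (f := fun a y => G (a, y)) hG continuous_const continuous_id)
  have hq : Continuous q := (hQ.comp (by fun_prop : Continuous fun b : ℝ => (b, b))).sub
    (continuous_intervalIntegral (f := fun b x => G (x, b)) (hG.comp continuous_swap)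
      continuous_const continuous_id)
  let F (z : ℝ × ℝ) : ℝ := F₀ 0 + ((∫ x in (0 : ℝ)..z.1, p x) + (∫ y in (0 : ℝ)..z.2, q y) +
    ∫ x in (0 : ℝ)..z.1, ∫ y in (0 : ℝ)..z.2, G (x, y))
  have hF (z : ℝ × ℝ) : HasFDerivAt F (covector (p z.1 + ∫ y in (0 : ℝ)..z.2, G (z.1, y))
      (q z.2 + ∫ x in (0 : ℝ)..z.1, G (x, z.2))) z := by
    have hp' := (hp.integral_hasStrictDerivAt 0 z.1).hasDerivAt.comp_hasFDerivAt z
      (hasFDerivAt_fst (𝕜 := ℝ))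
    have hq' := (hq.integral_hasStrictDerivAt 0 z.2).hasDerivAt.comp_hasFDerivAt z
      (hasFDerivAt_snd (𝕜 := ℝ))
    have hsum := ((hp'.add hq').add (hasFDerivAt_iteratedIntegral hG z)).const_add (F₀ 0)
    exact hsum.congr_fderiv (by ext <;> simp)
  have hF' (z : ℝ × ℝ) (hz : |z.1 - z.2| < W) : HasFDerivAt F (covector (P z) (Q z)) z := by
    have hPz : P (z.1, z.2) = p z.1 + ∫ y in (0 : ℝ)..z.2, G (z.1, y) :=
      eq_sub_integral_add_integral_of_hasDerivAt (by fun_prop) fun y hy =>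
        hPG _ _ (by rw [abs_sub_comm] at hz ⊢; exact (abs_sub_left_of_mem_uIcc hy).trans_lt hz)
    have hQz : Q (z.1, z.2) = q z.2 + ∫ x in (0 : ℝ)..z.1, G (x, z.2) :=
      eq_sub_integral_add_integral_of_hasDerivAt (f := fun x => Q (x, z.2)) (by fun_prop)
        fun x hx => hQG _ _ ((abs_sub_left_of_mem_uIcc hx).trans_lt hz)
    exact hPz ▸ hQz ▸ hF z
  exact ⟨F, eq_on_diagonal_of_hasFDerivAt (fun a => hF' (a, a) (by simpa using hW)) hF₀
    (by simp [F]), hF'⟩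

end PlaneCalculus

section Goursat

/-- The point of `[a - W, a + W]` nearest to `b`. -/
noncomputable def clampAround (W a b : ℝ) : ℝ := max (a - W) (min b (a + W))

lemma abs_clampAround_sub_le {W : ℝ} (hW : 0 ≤ W) (a b : ℝ) : |clampAround W a b - a| ≤ W := by
  have hle : clampAround W a b ≤ a + W := max_le (by linarith) (min_le_right _ _)
  have hge : a - W ≤ clampAround W a b := le_max_left _ _
  rw [abs_le]
  constructor <;> linarith

lemma clampAround_eq {W a b : ℝ} (h : |a - b| ≤ W) : clampAround W a b = b := by
  rw [abs_le] at h
  rw [clampAround, min_eq_left (by linarith), max_eq_right (by linarith)]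

/-- The integral of `g` along the vertical segment from the diagonal point `(z.1, z.1)` to `z`,
stopped where it leaves the strip `|z.1 - z.2| ≤ W`: this makes it a bounded operator on bounded
functions of the whole plane. -/
noncomputable def stripIntegral (W : ℝ) (g : ℝ × ℝ → ℝ) (z : ℝ × ℝ) : ℝ :=
  ∫ y in z.1..clampAround W z.1 z.2, g (z.1, y)

variable {W : ℝ} {g : ℝ × ℝ → ℝ}

lemma continuous_stripIntegral (W : ℝ) (hg : Continuous g) : Continuous (stripIntegral W g) :=
  continuous_intervalIntegral (f := fun (z : ℝ × ℝ) y => g (z.1, y)) (by fun_prop)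
    continuous_fst (by unfold clampAround; fun_prop)

lemma abs_stripIntegral_le (hW : 0 ≤ W) {B : ℝ} (hg : ∀ z, |g z| ≤ B) (z : ℝ × ℝ) :
    |stripIntegral W g z| ≤ B * W :=
  (intervalIntegral.norm_integral_le_of_norm_le_const (f := fun y => g (z.1, y))
    fun y _ => hg (z.1, y)).trans <|
    mul_le_mul_of_nonneg_left (abs_clampAround_sub_le hW z.1 z.2) ((abs_nonneg _).trans (hg 0))

lemma stripIntegral_sub {h : ℝ × ℝ → ℝ} (hg : Continuous g) (hh : Continuous h) (z : ℝ × ℝ) :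
    stripIntegral W (fun z => g z - h z) z = stripIntegral W g z - stripIntegral W h z :=
  intervalIntegral.integral_sub (Continuous.intervalIntegrable (by fun_prop) _ _)
    (Continuous.intervalIntegrable (by fun_prop) _ _)

lemma stripIntegral_diagonal (hW : 0 ≤ W) (a : ℝ) : stripIntegral W g (a, a) = 0 := by
  rw [stripIntegral, clampAround_eq (by simpa using hW), intervalIntegral.integral_same]

lemma hasDerivAt_stripIntegral (hg : Continuous g) {a b : ℝ} (hab : |a - b| < W) :
    HasDerivAt (fun y => stripIntegral W g (a, y)) (g (a, b)) b := by
  have hslice : Continuous fun y => g (a, y) := by fun_prop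
  have hev : ∀ᶠ y in 𝓝 b, |a - y| < W :=
    (by fun_prop : Continuous fun y : ℝ => |a - y|).continuousAt.eventually_lt_const hab
  refine (hslice.integral_hasStrictDerivAt a b).hasDerivAt.congr_of_eventuallyEq ?_
  filter_upwards [hev] with y hy
  rw [stripIntegral, clampAround_eq hy.le]

variable {m n : ℝ × ℝ → ℝ} {p q : ℝ → ℝ} {κ M : ℝ}

/-- The right-hand side `m P + n Q` of the Goursat problem, where `P` and `Q` are recovered from
the mixed derivative `G = P_b = Q_a` and the values `p`, `q` on the diagonal. -/
noncomputable def goursatMap (W : ℝ) (m n : ℝ × ℝ → ℝ) (p q : ℝ → ℝ) (G : ℝ × ℝ → ℝ)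
    (z : ℝ × ℝ) : ℝ :=
  m z * (p z.1 + stripIntegral W G z) + n z * (q z.2 + stripIntegral W (G ∘ Prod.swap) z.swap)

lemma continuous_goursatMap (W : ℝ) (hm : Continuous m) (hn : Continuous n) (hp : Continuous p)
    (hq : Continuous q) {G : ℝ × ℝ → ℝ} (hG : Continuous G) :
    Continuous (goursatMap W m n p q G) :=
  (hm.mul ((hp.comp continuous_fst).add (continuous_stripIntegral W hG))).add <|
    hn.mul ((hq.comp continuous_snd).add
      ((continuous_stripIntegral W (hG.comp continuous_swap)).comp continuous_swap))

lemma abs_goursatMap_le (hW : 0 ≤ W) (hm : ∀ z, |m z| ≤ κ) (hn : ∀ z, |n z| ≤ κ)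
    (hp : ∀ a, |p a| ≤ M) (hq : ∀ b, |q b| ≤ M) {G : ℝ × ℝ → ℝ} {B : ℝ} (hG : ∀ z, |G z| ≤ B)
    (z : ℝ × ℝ) : |goursatMap W m n p q G z| ≤ 2 * κ * (M + B * W) := by
  have hκ : 0 ≤ κ := (abs_nonneg _).trans (hm 0)
  have hP : |p z.1 + stripIntegral W G z| ≤ M + B * W :=
    (abs_add_le _ _).trans (add_le_add (hp _) (abs_stripIntegral_le hW hG z))
  have hQ : |q z.2 + stripIntegral W (G ∘ Prod.swap) z.swap| ≤ M + B * W :=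
    (abs_add_le _ _).trans (add_le_add (hq _) (abs_stripIntegral_le hW (fun z => hG z.swap) _))
  calc |goursatMap W m n p q G z|
      ≤ |m z| * |p z.1 + stripIntegral W G z| +
        |n z| * |q z.2 + stripIntegral W (G ∘ Prod.swap) z.swap| := by
        rw [← abs_mul, ← abs_mul]; exact abs_add_le _ _
    _ ≤ κ * (M + B * W) + κ * (M + B * W) := by gcongr <;> first | exact hm z | exact hn z
    _ = 2 * κ * (M + B * W) := by ring

lemma goursatMap_sub {G H : ℝ × ℝ → ℝ} (hG : Continuous G) (hH : Continuous H) (z : ℝ × ℝ) :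
    goursatMap W m n p q G z - goursatMap W m n p q H z =
      goursatMap W m n 0 0 (fun z => G z - H z) z := by
  have hswap : (fun z => G z - H z) ∘ Prod.swap =
      fun z => (G ∘ Prod.swap) z - (H ∘ Prod.swap) z := rfl
  rw [goursatMap, goursatMap, goursatMap, hswap, stripIntegral_sub hG hH,
    stripIntegral_sub (hG.comp continuous_swap) (hH.comp continuous_swap)]
  simp only [Pi.zero_apply]
  ring

lemma exists_goursatMap_fixedPoint (hW : 0 ≤ W) (hκW : 4 * κ * W ≤ 1) (hm : Continuous m)
    (hn : Continuous n) (hp : Continuous p) (hq : Continuous q) (hmκ : ∀ z, |m z| ≤ κ)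
    (hnκ : ∀ z, |n z| ≤ κ) (hpM : ∀ a, |p a| ≤ M) (hqM : ∀ b, |q b| ≤ M) :
    ∃ G : ℝ × ℝ → ℝ, Continuous G ∧ (∀ z, |G z| ≤ 4 * κ * M) ∧ goursatMap W m n p q G = G := by
  let Φ (G : ℝ × ℝ →ᵇ ℝ) : ℝ × ℝ →ᵇ ℝ :=
    .ofNormedAddCommGroup (goursatMap W m n p q G)
      (continuous_goursatMap W hm hn hp hq G.continuous) _
      (abs_goursatMap_le hW hmκ hnκ hpM hqM G.norm_coe_le_norm)
  have hΦ : ContractingWith (1 / 2) Φ := by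
    refine ⟨by rw [← NNReal.coe_lt_coe]; norm_num, LipschitzWith.of_dist_le_mul fun G H => ?_⟩
    refine (BoundedContinuousFunction.dist_le (by positivity)).2 fun z => ?_
    have hdiff : dist (Φ G z) (Φ H z) = |goursatMap W m n 0 0 (fun z => G z - H z) z| := by
      rw [← goursatMap_sub G.continuous H.continuous]; rfl
    have hle := abs_goursatMap_le (M := 0) (p := 0) (q := 0) hW hmκ hnκ (by simp) (by simp)
      (fun z => G.dist_coe_le_dist (g := H) z) z
    have hhalf : ((1 / 2 : ℝ≥0) : ℝ) = 1 / 2 := by norm_num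
    rw [hdiff, hhalf]
    nlinarith [dist_nonneg (x := G) (y := H)]
  obtain ⟨G, hG⟩ : ∃ G, Φ G = G := ⟨_, hΦ.fixedPoint_isFixedPt⟩
  have hGz (z) : goursatMap W m n p q G z = G z := DFunLike.congr_fun hG z
  have hκ : 0 ≤ κ := (abs_nonneg _).trans (hmκ 0)
  have hM : 0 ≤ M := (abs_nonneg _).trans (hpM 0)
  have hnorm : ‖G‖ ≤ 2 * κ * (M + ‖G‖ * W) :=
    (BoundedContinuousFunction.norm_le (by positivity)).2 fun z => by
      rw [← hGz]; exact abs_goursatMap_le hW hmκ hnκ hpM hqM G.norm_coe_le_norm z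
  refine ⟨G, G.continuous, fun z => (G.norm_coe_le_norm z).trans ?_, funext hGz⟩
  nlinarith [norm_nonneg G]

theorem exists_goursat (hW : 0 ≤ W) (hκW : 4 * κ * W ≤ 1) (hm : Continuous m)
    (hn : Continuous n) (hp : Continuous p) (hq : Continuous q) (hmκ : ∀ z, |m z| ≤ κ)
    (hnκ : ∀ z, |n z| ≤ κ) (hpM : ∀ a, |p a| ≤ M) (hqM : ∀ b, |q b| ≤ M) :
    ∃ P Q : ℝ × ℝ → ℝ, Continuous P ∧ Continuous Q ∧
      (∀ a, P (a, a) = p a) ∧ (∀ b, Q (b, b) = q b) ∧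
      (∀ z, |P z - p z.1| ≤ 4 * κ * M * W) ∧ (∀ z, |Q z - q z.2| ≤ 4 * κ * M * W) ∧
      (∀ a b, |a - b| < W → HasDerivAt (fun y => P (a, y))
        (m (a, b) * P (a, b) + n (a, b) * Q (a, b)) b) ∧
      (∀ a b, |a - b| < W → HasDerivAt (fun x => Q (x, b))
        (m (a, b) * P (a, b) + n (a, b) * Q (a, b)) a) := by
  obtain ⟨G, hG, hGκ, hfix⟩ := exists_goursatMap_fixedPoint hW hκW hm hn hp hq hmκ hnκ hpM hqM
  have hGs : Continuous (G ∘ Prod.swap) := hG.comp continuous_swap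
  refine ⟨fun z => p z.1 + stripIntegral W G z,
    fun z => q z.2 + stripIntegral W (G ∘ Prod.swap) z.swap,
    (hp.comp continuous_fst).add (continuous_stripIntegral W hG),
    (hq.comp continuous_snd).add ((continuous_stripIntegral W hGs).comp continuous_swap),
    fun a => by simp [stripIntegral_diagonal hW], fun b => by simp [stripIntegral_diagonal hW],
    fun z => ?_, fun z => ?_, fun a b hab => ?_, fun a b hab => ?_⟩
  · rw [add_sub_cancel_left]
    exact abs_stripIntegral_le hW hGκ z
  · rw [add_sub_cancel_left]
    exact abs_stripIntegral_le hW (fun z => hGκ z.swap) z.swap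
  · exact ((hasDerivAt_stripIntegral hG hab).const_add (p a)).congr_deriv
      (congrFun hfix (a, b)).symm
  · rw [abs_sub_comm] at hab
    exact ((hasDerivAt_stripIntegral hGs hab).const_add (q b)).congr_deriv
      (congrFun hfix (a, b)).symm

end Goursat

section CharacteristicLabels

/-- The strip of width `W` around the diagonal of the plane of characteristic labels. -/
def strip (W : ℝ) : Set (ℝ × ℝ) := {z | |z.1 - z.2| < W}

/-- The set of points `(t, x)` of the plane with `|t| < T`. -/
def timeSlab (T : ℝ) : Set (ℝ × ℝ) := {q | |q.1| < T}

lemma isOpen_strip (W : ℝ) : IsOpen (strip W) := isOpen_lt (by fun_prop) continuous_const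

lemma convex_strip (W : ℝ) : Convex ℝ (strip W) := by
  have h : strip W = (covector 1 (-1) : ℝ × ℝ →L[ℝ] ℝ) ⁻¹' Ioo (-W) W := by
    ext z
    simp [strip, abs_lt, ← sub_eq_add_neg]
  rw [h]
  exact (convex_Ioo _ _).linear_preimage (covector 1 (-1)).toLinearMap

lemma diagonal_mem_strip {W : ℝ} (hW : 0 < W) (a : ℝ) : (a, a) ∈ strip W := by
  simpa [strip] using hW

lemma closedBall_diagonal_subset_strip {r W : ℝ} (h : 2 * r < W) (a : ℝ) :
    Metric.closedBall (a, a) r ⊆ strip W := by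
  intro z hz
  rw [Metric.mem_closedBall, Prod.dist_eq, max_le_iff, Real.dist_eq, Real.dist_eq] at hz
  have htri := abs_sub_le z.1 a z.2
  rw [abs_sub_comm a] at htri
  exact htri.trans_lt (by linarith [hz.1, hz.2])

/-- The differential of `(t, x)` with respect to characteristic labels for `x_a = p`, `x_b = q`
and speed `l`, so that `t_a = p / l` and `t_b = -q / l`. -/
noncomputable def labelEquiv {p q l : ℝ} (hp : p ≠ 0) (hq : q ≠ 0) (hl : l ≠ 0) :
    (ℝ × ℝ) ≃L[ℝ] (ℝ × ℝ) :=
  ContinuousLinearEquiv.equivOfInverse ((covector (p / l) (-q / l)).prod (covector p q))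
    ((covector (l / (2 * p)) (1 / (2 * p))).prod (covector (-l / (2 * q)) (1 / (2 * q))))
    (fun z => by ext <;> simp <;> field_simp <;> ring)
    (fun z => by ext <;> simp <;> field_simp <;> ring)

/-- The differential of `(t, x)` with respect to characteristic labels for the linear wave
equation with speed `1`, namely `t = (a - b) / 2` and `x = (a + b) / 2`. -/
noncomputable def flatLabelEquiv : (ℝ × ℝ) ≃L[ℝ] (ℝ × ℝ) :=
  labelEquiv (one_half_pos (α := ℝ)).ne' (one_half_pos (α := ℝ)).ne' one_ne_zero

lemma half_le_inv_nnnorm_flatLabelEquiv_symm :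
    1 / 2 ≤ ‖(flatLabelEquiv.symm : ℝ × ℝ →L[ℝ] ℝ × ℝ)‖₊⁻¹ := by
  have hle : ‖(flatLabelEquiv.symm : ℝ × ℝ →L[ℝ] ℝ × ℝ)‖₊ ≤ 2 := by
    have hcoe : (flatLabelEquiv.symm : ℝ × ℝ →L[ℝ] ℝ × ℝ) =
      (covector (1 / (2 * (1 / 2))) (1 / (2 * (1 / 2)))).prod
        (covector (-1 / (2 * (1 / 2))) (1 / (2 * (1 / 2)))) := rfl
    rw [← NNReal.coe_le_coe, coe_nnnorm, hcoe, ContinuousLinearMap.opNorm_prod]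
    refine max_le ?_ ?_ <;> refine (norm_covector_le _ _).trans ?_ <;> norm_num
  have hpos : 0 < ‖(flatLabelEquiv.symm : ℝ × ℝ →L[ℝ] ℝ × ℝ)‖₊ :=
    flatLabelEquiv.subsingleton_or_nnnorm_symm_pos.resolve_left (not_subsingleton _)
  rw [one_div]
  exact inv_anti₀ hpos hle

lemma abs_div_sub_half_le {p l : ℝ} (hp : |p - 1 / 2| ≤ 1 / 20) (hl : |l - 1| ≤ 1 / 10) :
    |p / l - 1 / 2| ≤ 1 / 8 := by
  obtain ⟨hp₁, hp₂⟩ := abs_le.1 hp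
  obtain ⟨hl₁, hl₂⟩ := abs_le.1 hl
  have hl0 : 0 < l := by linarith
  have hge : 3 / 8 ≤ p / l := (le_div_iff₀ hl0).2 (by linarith)
  have hle : p / l ≤ 5 / 8 := (div_le_iff₀ hl0).2 (by linarith)
  rw [abs_le]
  constructor <;> linarith

lemma norm_labelEquiv_sub_flatLabelEquiv_le {p q l : ℝ} (hp0 : p ≠ 0) (hq0 : q ≠ 0) (hl0 : l ≠ 0)
    (hp : |p - 1 / 2| ≤ 1 / 20) (hq : |q - 1 / 2| ≤ 1 / 20) (hl : |l - 1| ≤ 1 / 10) :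
    ‖(labelEquiv hp0 hq0 hl0 - flatLabelEquiv : ℝ × ℝ →L[ℝ] ℝ × ℝ)‖ ≤ 1 / 4 := by
  have hdiff : (labelEquiv hp0 hq0 hl0 - flatLabelEquiv : ℝ × ℝ →L[ℝ] ℝ × ℝ) =
      (covector (p / l - 1 / 2) (-(q / l - 1 / 2))).prod (covector (p - 1 / 2) (q - 1 / 2)) := by
    have hflat : covector (1 / 2 / 1) (-(1 / 2) / 1) = covector (1 / 2) (-(1 / 2)) := by simp
    have hneg : -q / l - -(1 / 2) = -(q / l - 1 / 2) := by ring
    rw [← covector_sub p q, ← hneg, ← covector_sub (p / l), ← hflat]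
    rfl
  have hpl := abs_div_sub_half_le hp hl
  have hql := abs_div_sub_half_le hq hl
  rw [hdiff, ContinuousLinearMap.opNorm_prod]
  refine max_le ?_ ?_ <;> refine (norm_covector_le _ _).trans ?_
  · rw [abs_neg]; linarith
  · linarith

/-- The slopes `P = x_a`, `Q = x_b` and the speed `L` are close to their values `1/2`, `1/2`, `1`
for the linear wave equation with speed `1`. -/
structure NearFlat (P Q L : ℝ × ℝ → ℝ) : Prop where
  left (z) : |P z - 1 / 2| ≤ 1 / 20
  right (z) : |Q z - 1 / 2| ≤ 1 / 20
  speed (z) : |L z - 1| ≤ 1 / 10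

namespace NearFlat

variable {P Q L : ℝ × ℝ → ℝ} (h : NearFlat P Q L)

include h

lemma left_ge (z : ℝ × ℝ) : 9 / 20 ≤ P z := by linarith [(abs_le.1 (h.left z)).1]

lemma right_ge (z : ℝ × ℝ) : 9 / 20 ≤ Q z := by linarith [(abs_le.1 (h.right z)).1]

lemma left_ne_zero (z : ℝ × ℝ) : P z ≠ 0 := by linarith [h.left_ge z]

lemma right_ne_zero (z : ℝ × ℝ) : Q z ≠ 0 := by linarith [h.right_ge z]

lemma speed_ne_zero (z : ℝ × ℝ) : L z ≠ 0 := by linarith [(abs_le.1 (h.speed z)).1]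

end NearFlat

theorem exists_inverse_of_near_flatLabelEquiv {Φ : ℝ × ℝ → ℝ × ℝ}
    {E : ℝ × ℝ → (ℝ × ℝ) ≃L[ℝ] (ℝ × ℝ)} {T : ℝ} (hT : 0 < T)
    (hΦ : ∀ z ∈ strip (9 * T), HasFDerivAt Φ (E z : ℝ × ℝ →L[ℝ] ℝ × ℝ) z)
    (hE : ∀ z ∈ strip (9 * T), ‖(E z - flatLabelEquiv : ℝ × ℝ →L[ℝ] ℝ × ℝ)‖ ≤ 1 / 4)
    (hdiag : ∀ a, Φ (a, a) = (0, a)) :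
    ∃ Z : ℝ × ℝ → ℝ × ℝ, (∀ x, Z (0, x) = (x, x)) ∧ ∀ q ∈ timeSlab T, Z q ∈ strip (9 * T) ∧
      HasFDerivAt Z ((E (Z q)).symm : ℝ × ℝ →L[ℝ] ℝ × ℝ) q := by
  have happrox : ApproximatesLinearOn Φ (flatLabelEquiv : ℝ × ℝ →L[ℝ] ℝ × ℝ) (strip (9 * T))
      (1 / 4) := by
    intro z hz y hy
    have hle := (convex_strip (9 * T)).norm_image_sub_le_of_norm_hasFDerivWithin_le'
      (fun z hz => (hΦ z hz).hasFDerivWithinAt) hE hy hz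
    simpa using hle
  have hhalf := half_le_inv_nnnorm_flatLabelEquiv_symm
  have hlt : (1 / 4 : ℝ≥0) < ‖(flatLabelEquiv.symm : ℝ × ℝ →L[ℝ] ℝ × ℝ)‖₊⁻¹ :=
    lt_of_lt_of_le (by rw [← NNReal.coe_lt_coe]; norm_num) hhalf
  let H := happrox.toOpenPartialHomeomorph Φ (strip (9 * T)) (.inr hlt) (isOpen_strip _)
  have hslab {q : ℝ × ℝ} (hq : q ∈ timeSlab T) : q ∈ H.target := by
    refine happrox.closedBall_subset_target (.inr hlt) (isOpen_strip _) (b := (q.2, q.2))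
      (ε := 4 * T) (by positivity) (closedBall_diagonal_subset_strip (by linarith) q.2) ?_
    have hradius : T ≤ ((‖(flatLabelEquiv.symm : ℝ × ℝ →L[ℝ] ℝ × ℝ)‖₊⁻¹ : ℝ≥0) -
        ((1 / 4 : ℝ≥0) : ℝ)) * (4 * T) := by
      have hhalf' := NNReal.coe_le_coe.2 hhalf
      push_cast at hhalf' ⊢
      nlinarith
    refine Metric.closedBall_subset_closedBall hradius ?_
    rw [hdiag, Metric.mem_closedBall, Prod.dist_eq, dist_self, Real.dist_eq, sub_zero]
    exact max_le (le_of_lt hq) hT.le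
  refine ⟨H.symm, fun x => ?_, fun q hq => ?_⟩
  · have hleft := H.left_inv (diagonal_mem_strip (by positivity) x)
    rwa [show H (x, x) = (0, x) from hdiag x] at hleft
  · have hmem : H.symm q ∈ strip (9 * T) := H.map_target (hslab hq)
    exact ⟨hmem, H.hasFDerivAt_symm (hslab hq) (hΦ _ hmem)⟩

/-- `Z (t, x)` are the characteristic labels `(a, b)` of the point `(t, x)`: the coordinates at
time `0` of the two characteristics through it, when the speed `L` is a known function of the
labels. Thus `Z` solves `a_t = L a_x`, `b_t = -L b_x` for `|t| < T`. -/
structure IsCharacteristicLabel (L : ℝ × ℝ → ℝ) (T : ℝ) (Z : ℝ × ℝ → ℝ × ℝ)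
    (ax bx : ℝ × ℝ → ℝ) : Prop where
  initial (x) : Z (0, x) = (x, x)
  hasFDerivAt : ∀ q ∈ timeSlab T, HasFDerivAt Z ((covector (L (Z q) * ax q) (ax q)).prod
    (covector (-(L (Z q) * bx q)) (bx q))) q
  continuousOn_ax : ContinuousOn ax (timeSlab T)
  continuousOn_bx : ContinuousOn bx (timeSlab T)
  abs_ax_le (q) : |ax q| ≤ 2
  abs_bx_le (q) : |bx q| ≤ 2

lemma IsCharacteristicLabel.continuousOn {L : ℝ × ℝ → ℝ} {T : ℝ} {Z : ℝ × ℝ → ℝ × ℝ}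
    {ax bx : ℝ × ℝ → ℝ} (h : IsCharacteristicLabel L T Z ax bx) : ContinuousOn Z (timeSlab T) :=
  fun q hq => (h.hasFDerivAt q hq).continuousAt.continuousWithinAt

theorem NearFlat.exists_isCharacteristicLabel {P Q L t x : ℝ × ℝ → ℝ} (h : NearFlat P Q L)
    (hP : Continuous P) (hQ : Continuous Q) {T : ℝ} (hT : 0 < T)
    (ht : ∀ z ∈ strip (9 * T), HasFDerivAt t (covector (P z / L z) (-Q z / L z)) z)
    (hx : ∀ z ∈ strip (9 * T), HasFDerivAt x (covector (P z) (Q z)) z)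
    (ht0 : ∀ a, t (a, a) = 0) (hx0 : ∀ a, x (a, a) = a) :
    ∃ Z ax bx, IsCharacteristicLabel L T Z ax bx := by
  obtain ⟨Z, hZ0, hZ⟩ := exists_inverse_of_near_flatLabelEquiv (Φ := fun z => (t z, x z))
    (E := fun z => labelEquiv (h.left_ne_zero z) (h.right_ne_zero z) (h.speed_ne_zero z)) hT
    (fun z hz => (ht z hz).prodMk (hx z hz))
    (fun z _ => norm_labelEquiv_sub_flatLabelEquiv_le _ _ _ (h.left z) (h.right z) (h.speed z))
    (fun a => by rw [ht0, hx0])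
  have hcont : ContinuousOn Z (timeSlab T) := fun q hq =>
    (hZ q hq).2.continuousAt.continuousWithinAt
  have hbound {y : ℝ} (hy : 9 / 20 ≤ y) : |1 / (2 * y)| ≤ 2 := by
    rw [abs_of_pos (by positivity), div_le_iff₀ (by positivity)]
    linarith
  exact ⟨Z, fun q => 1 / (2 * P (Z q)), fun q => 1 / (2 * Q (Z q)), {
    initial := hZ0
    hasFDerivAt := fun q hq => by
      rw [mul_one_div, mul_one_div, ← neg_div]
      exact (hZ q hq).2
    continuousOn_ax := continuousOn_const.div (continuousOn_const.mul (hP.comp_continuousOn hcont))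
      fun q _ => mul_ne_zero two_ne_zero (h.left_ne_zero _)
    continuousOn_bx := continuousOn_const.div (continuousOn_const.mul (hQ.comp_continuousOn hcont))
      fun q _ => mul_ne_zero two_ne_zero (h.right_ne_zero _)
    abs_ax_le := fun q => hbound (h.left_ge _)
    abs_bx_le := fun q => hbound (h.right_ge _) }⟩

/- Equality of the mixed derivatives of `x`, `P_b = Q_a`, and of `t`, `(P / L)_b = (-Q / L)_a`,
forces both to equal `(L_b P + L_a Q) / (2 L)`. -/
lemma exists_nearFlat_goursat {L : ℝ × ℝ → ℝ} (hL : ContDiff ℝ 1 L)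
    (hL1 : ∀ z, |L z - 1| ≤ 1 / 10) {κ W : ℝ} (hκ : ∀ z, ‖fderiv ℝ L z‖ ≤ κ) (hW : 0 ≤ W)
    (hκW : 40 * κ * W ≤ 1) :
    ∃ P Q G : ℝ × ℝ → ℝ, NearFlat P Q L ∧ Continuous P ∧ Continuous Q ∧ Continuous G ∧
      (∀ a, P (a, a) = 1 / 2) ∧ (∀ b, Q (b, b) = 1 / 2) ∧
      (∀ z, 2 * L z * G z = fderiv ℝ L z (0, 1) * P z + fderiv ℝ L z (1, 0) * Q z) ∧
      (∀ a b, |a - b| < W → HasDerivAt (fun y => P (a, y)) (G (a, b)) b) ∧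
      (∀ a b, |a - b| < W → HasDerivAt (fun x => Q (x, b)) (G (a, b)) a) := by
  have hL9 (z) : 9 / 10 ≤ L z := by linarith [(abs_le.1 (hL1 z)).1]
  have hL2 (z) : 2 * L z ≠ 0 := by linarith [hL9 z]
  have hκ0 : 0 ≤ κ := (norm_nonneg _).trans (hκ 0)
  have hcont (e : ℝ × ℝ) : Continuous fun z => fderiv ℝ L z e / (2 * L z) :=
    ((hL.continuous_fderiv one_ne_zero).clm_apply continuous_const).div
      (continuous_const.mul hL.continuous) hL2
  have hcoef {e : ℝ × ℝ} (he : ‖e‖ ≤ 1) (z) : |fderiv ℝ L z e / (2 * L z)| ≤ κ := by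
    have hle := (fderiv ℝ L z).le_of_opNorm_le_of_le (hκ z) he
    rw [abs_div, abs_of_pos (by linarith [hL9 z] : 0 < 2 * L z), div_le_iff₀ (by linarith [hL9 z])]
    rw [Real.norm_eq_abs] at hle
    nlinarith [hL9 z]
  have hhalf (_ : ℝ) : |(1 / 2 : ℝ)| ≤ 1 / 2 := by norm_num
  obtain ⟨P, Q, hP, hQ, hP0, hQ0, hPle, hQle, hPG, hQG⟩ := exists_goursat hW (by nlinarith)
    (hcont (0, 1)) (hcont (1, 0)) continuous_const continuous_const (hcoef (by simp))
    (hcoef (by simp)) hhalf hhalf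
  refine ⟨P, Q, fun z => fderiv ℝ L z (0, 1) / (2 * L z) * P z + fderiv ℝ L z (1, 0) / (2 * L z) *
    Q z, ⟨fun z => (hPle z).trans ?_, fun z => (hQle z).trans ?_, hL1⟩, hP, hQ,
    ((hcont (0, 1)).mul hP).add ((hcont (1, 0)).mul hQ), hP0, hQ0, fun z => ?_, hPG, hQG⟩
  · linarith
  · linarith
  · have hLz : L z ≠ 0 := by linarith [hL9 z]
    field_simp

theorem exists_isCharacteristicLabel {L : ℝ × ℝ → ℝ} (hL : ContDiff ℝ 1 L)
    (hL1 : ∀ z, |L z - 1| ≤ 1 / 10) {κ T : ℝ} (hκ : ∀ z, ‖fderiv ℝ L z‖ ≤ κ) (hT : 0 < T)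
    (hκT : 360 * κ * T ≤ 1) : ∃ Z ax bx, IsCharacteristicLabel L T Z ax bx := by
  obtain ⟨P, Q, G, h, hP, hQ, hG, hP0, hQ0, hLG, hPG, hQG⟩ :=
    exists_nearFlat_goursat hL hL1 hκ (W := 9 * T) (by positivity) (by linarith)
  have hd (z) : HasFDerivAt L (covector (fderiv ℝ L z (1, 0)) (fderiv ℝ L z (0, 1))) z := by
    rw [covector_eq]
    exact (hL.differentiable one_ne_zero).differentiableAt.hasFDerivAt
  have hG' : Continuous fun z => (G z * L z - P z * fderiv ℝ L z (0, 1)) / L z ^ 2 :=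
    ((hG.mul hL.continuous).sub (hP.mul ((hL.continuous_fderiv one_ne_zero).clm_apply
      continuous_const))).div (hL.continuous.pow 2) fun z => pow_ne_zero 2 (h.speed_ne_zero z)
  obtain ⟨x, hx0, hx⟩ := exists_potential (by positivity) hP hQ hG hPG hQG (F₀ := fun a => a)
    fun a => (hasDerivAt_id' a).congr_deriv (by rw [hP0, hQ0]; norm_num)
  obtain ⟨t, ht0, ht⟩ := exists_potential (P := fun z => P z / L z) (Q := fun z => -Q z / L z)
    (F₀ := 0) (by positivity) (hP.div hL.continuous h.speed_ne_zero)
    (hQ.neg.div hL.continuous h.speed_ne_zero) hG'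
    (fun a b hab => (hPG a b hab).div (hasDerivAt_slice_snd (hd (a, b))) (h.speed_ne_zero _))
    (fun a b hab => ((hQG a b hab).neg.div (hasDerivAt_slice_fst (hd (a, b)))
      (h.speed_ne_zero _)).congr_deriv <| by
      congr 1
      simp only [Pi.neg_apply]
      linear_combination -hLG (a, b))
    (fun a => (hasDerivAt_const a 0).congr_deriv (by rw [hP0, hQ0]; ring))
  exact h.exists_isCharacteristicLabel hP hQ hT ht hx ht0 hx0

end CharacteristicLabels

section FirstOrderSystem

lemma isOpen_timeSlab (T : ℝ) : IsOpen (timeSlab T) := isOpen_lt (by fun_prop) continuous_const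

lemma convex_timeSlab (T : ℝ) : Convex ℝ (timeSlab T) := by
  have h : timeSlab T = (ContinuousLinearMap.fst ℝ ℝ ℝ) ⁻¹' Ioo (-T) T := by
    ext q
    simp [timeSlab, abs_lt]
  rw [h]
  exact (convex_Ioo _ _).linear_preimage (ContinuousLinearMap.fst ℝ ℝ ℝ).toLinearMap

lemma mk_mem_timeSlab {T t : ℝ} (ht : t ∈ Ico 0 T) (x : ℝ) : (t, x) ∈ timeSlab T :=
  (abs_of_nonneg ht.1).trans_lt ht.2

lemma dt_congr {f g : ℝ → ℝ → ℝ} {T t x : ℝ} (ht : t ∈ Ico 0 T)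
    (h : ∀ s ∈ Ico 0 T, f s x = g s x) : dt f t x = dt g t x := by
  refine EventuallyEq.derivWithin_eq ?_ (h t ht)
  filter_upwards [self_mem_nhdsWithin, mem_nhdsWithin_of_mem_nhds (Iio_mem_nhds ht.2)] with s h₀ h₁
  exact h s ⟨h₀, h₁⟩

lemma dx_congr {f g : ℝ → ℝ → ℝ} {t x : ℝ} (h : ∀ y, f t y = g t y) : dx f t x = dx g t x := by
  simp only [dx, h]

lemma dt_eq_of_hasFDerivAt {f : ℝ × ℝ → ℝ} {α β t x : ℝ} (ht : 0 ≤ t)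
    (h : HasFDerivAt f (covector α β) (t, x)) : dt (Function.curry f) t x = α :=
  (hasDerivAt_slice_fst h).hasDerivWithinAt.derivWithin (uniqueDiffOn_Ici 0 t ht)

lemma dx_eq_of_hasFDerivAt {f : ℝ × ℝ → ℝ} {α β t x : ℝ}
    (h : HasFDerivAt f (covector α β) (t, x)) : dx (Function.curry f) t x = β :=
  (hasDerivAt_slice_snd h).deriv

lemma contDiffOn_succ_of_hasFDerivAt {f α β : ℝ × ℝ → ℝ} {D : Set (ℝ × ℝ)} (hD : IsOpen D) {n : ℕ}
    (h : ∀ q ∈ D, HasFDerivAt f (covector (α q) (β q)) q) (hα : ContDiffOn ℝ n α D)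
    (hβ : ContDiffOn ℝ n β D) : ContDiffOn ℝ (n + 1 : ℕ) f D := by
  rw [Nat.cast_add_one, contDiffOn_succ_iff_hasFDerivWithinAt_of_uniqueDiffOn hD.uniqueDiffOn]
  exact ⟨fun h => by simp at h, _, (hα.smul contDiffOn_const).add (hβ.smul contDiffOn_const),
    fun q hq => (h q hq).hasFDerivWithinAt⟩

lemma eLpNorm_top_le_of_abs_le {f : ℝ → ℝ} {B : ℝ} (h : ∀ x, |f x| ≤ B) :
    eLpNorm f ∞ volume ≤ ENNReal.ofReal B := by
  rw [eLpNorm_exponent_top]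
  exact eLpNormEssSup_le_of_ae_bound (.of_forall h)

lemma enorm_inv_le_two {a : ℝ} (h : 1 / 2 ≤ a) : ‖a‖ₑ⁻¹ ≤ 2 := by
  rw [ENNReal.inv_le_iff_inv_le, Real.enorm_eq_ofReal (by linarith)]
  refine le_trans (le_of_eq ?_) (ENNReal.ofReal_le_ofReal h)
  rw [one_div, ENNReal.ofReal_inv_of_pos two_pos, ENNReal.ofReal_ofNat]

/-- For `|t| < T` the pair `(w, V) = (u_t, u_x)` is a `C¹` solution of `V_t = w_x`,
`w_t = c(V)² V_x` with first derivatives `wt`, `wx`, `Vx`; all five functions are bounded by `B`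
and the speed is bounded away from `0`. -/
structure IsSystemSolution (c : ℝ → ℝ) (T B : ℝ) (w V wt wx Vx : ℝ × ℝ → ℝ) : Prop where
  hasFDerivAt_w : ∀ q ∈ timeSlab T, HasFDerivAt w (covector (wt q) (wx q)) q
  hasFDerivAt_V : ∀ q ∈ timeSlab T, HasFDerivAt V (covector (wx q) (Vx q)) q
  continuousOn_wt : ContinuousOn wt (timeSlab T)
  continuousOn_wx : ContinuousOn wx (timeSlab T)
  continuousOn_Vx : ContinuousOn Vx (timeSlab T)
  wt_eq : ∀ q ∈ timeSlab T, wt q = c (V q) ^ 2 * Vx q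
  half_le_speed : ∀ q ∈ timeSlab T, 1 / 2 ≤ c (V q)
  abs_w_le : ∀ q ∈ timeSlab T, |w q| ≤ B
  abs_V_le : ∀ q ∈ timeSlab T, |V q| ≤ B
  abs_wt_le : ∀ q ∈ timeSlab T, |wt q| ≤ B
  abs_wx_le : ∀ q ∈ timeSlab T, |wx q| ≤ B
  abs_Vx_le : ∀ q ∈ timeSlab T, |Vx q| ≤ B

namespace IsSystemSolution

variable {c : ℝ → ℝ} {T B : ℝ} {u w V wt wx Vx : ℝ × ℝ → ℝ}

lemma exists_hasFDerivAt (h : IsSystemSolution c T B w V wt wx Vx) (hT : 0 < T) {u₀ : ℝ → ℝ}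
    (hu₀ : ∀ x, HasDerivAt u₀ (V (0, x)) x) :
    ∃ u : ℝ × ℝ → ℝ, (∀ x, u (0, x) = u₀ x) ∧
      ∀ q ∈ timeSlab T, HasFDerivAt u (covector (w q) (V q)) q := by
  have hω (q) (hq : q ∈ timeSlab T) : HasFDerivWithinAt (fun q => covector (w q) (V q))
      ((covector (wt q) (wx q)).smulRight (ContinuousLinearMap.fst ℝ ℝ ℝ) +
        (covector (wx q) (Vx q)).smulRight (ContinuousLinearMap.snd ℝ ℝ ℝ)) (timeSlab T) q :=
    (((h.hasFDerivAt_w q hq).smul_const _).add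
      ((h.hasFDerivAt_V q hq).smul_const _)).hasFDerivWithinAt
  obtain ⟨f, hf⟩ :=
    (convex_timeSlab T).exists_forall_hasFDerivWithinAt_of_hasFDerivWithinAt_symmetric hω
      fun q _ y _ z _ => by simp; ring
  have hu (q) (hq : q ∈ timeSlab T) :
      HasFDerivAt (fun q => f q - f 0 + u₀ 0) (covector (w q) (V q)) q :=
    (((hf q hq).hasFDerivAt ((isOpen_timeSlab T).mem_nhds hq)).sub_const _).add_const _
  refine ⟨fun q => f q - f 0 + u₀ 0, fun x => ?_, hu⟩
  have hderiv (x : ℝ) : HasDerivAt (fun x => f (0, x) - f 0 + u₀ 0 - u₀ x) 0 x :=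
    ((hasDerivAt_slice_snd (hu (0, x) (mk_mem_timeSlab (left_mem_Ico.2 hT) x))).sub
      (hu₀ x)).congr_deriv (sub_self _)
  have hconst := is_const_of_deriv_eq_zero (fun x => (hderiv x).differentiableAt)
    (fun x => (hderiv x).deriv) x 0
  rw [← Prod.zero_eq_mk, sub_self, zero_add, sub_self] at hconst
  exact sub_eq_zero.1 hconst

lemma dt_eq (hu : ∀ q ∈ timeSlab T, HasFDerivAt u (covector (w q) (V q)) q) {t : ℝ}
    (ht : t ∈ Ico 0 T) : dt (Function.curry u) t = fun x => w (t, x) :=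
  funext fun x => dt_eq_of_hasFDerivAt ht.1 (hu _ (mk_mem_timeSlab ht x))

lemma dx_eq (hu : ∀ q ∈ timeSlab T, HasFDerivAt u (covector (w q) (V q)) q) {t : ℝ}
    (ht : t ∈ Ico 0 T) : dx (Function.curry u) t = fun x => V (t, x) :=
  funext fun x => dx_eq_of_hasFDerivAt (hu _ (mk_mem_timeSlab ht x))

variable (h : IsSystemSolution c T B w V wt wx Vx)
  (hu : ∀ q ∈ timeSlab T, HasFDerivAt u (covector (w q) (V q)) q)

include h hu

lemma dt_dt_eq {t : ℝ} (ht : t ∈ Ico 0 T) : dt (dt (Function.curry u)) t = fun x => wt (t, x) :=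
  funext fun x => (dt_congr ht fun _ hs => congrFun (dt_eq hu hs) x).trans
    (dt_eq_of_hasFDerivAt ht.1 (h.hasFDerivAt_w _ (mk_mem_timeSlab ht x)))

lemma dx_dt_eq {t : ℝ} (ht : t ∈ Ico 0 T) : dx (dt (Function.curry u)) t = fun x => wx (t, x) :=
  funext fun x => (dx_congr fun y => congrFun (dt_eq hu ht) y).trans
    (dx_eq_of_hasFDerivAt (h.hasFDerivAt_w _ (mk_mem_timeSlab ht x)))

lemma dx_dx_eq {t : ℝ} (ht : t ∈ Ico 0 T) : dx (dx (Function.curry u)) t = fun x => Vx (t, x) :=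
  funext fun x => (dx_congr fun y => congrFun (dx_eq hu ht) y).trans
    (dx_eq_of_hasFDerivAt (h.hasFDerivAt_V _ (mk_mem_timeSlab ht x)))

lemma contDiffOn : ContDiffOn ℝ 2 u (timeSlab T) :=
  contDiffOn_succ_of_hasFDerivAt (n := 1) (isOpen_timeSlab T) hu
    (contDiffOn_succ_of_hasFDerivAt (n := 0) (isOpen_timeSlab T) h.hasFDerivAt_w
      (contDiffOn_zero.2 h.continuousOn_wt) (contDiffOn_zero.2 h.continuousOn_wx))
    (contDiffOn_succ_of_hasFDerivAt (n := 0) (isOpen_timeSlab T) h.hasFDerivAt_V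
      (contDiffOn_zero.2 h.continuousOn_wx) (contDiffOn_zero.2 h.continuousOn_Vx))

lemma isClassicalSolution {U : Set ℝ} (hU : ∀ q ∈ timeSlab T, V q ∈ U) (hT : 0 < T) :
    IsClassicalSolution U c (fun x => u (0, x)) (fun x => w (0, x)) T (Function.curry u) where
  contDiffOn := (h.contDiffOn hu).mono fun q hq => mk_mem_timeSlab hq.1 q.2
  mem_domain t ht x := by
    rw [dx_eq hu ht]
    exact hU _ (mk_mem_timeSlab ht x)
  equation t ht x := by
    rw [h.dt_dt_eq hu ht, dx_eq hu ht, h.dx_dx_eq hu ht, sub_eq_zero]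
    exact h.wt_eq _ (mk_mem_timeSlab ht x)
  initial_pos _ := rfl
  initial_vel x := by rw [dt_eq hu (left_mem_Ico.2 hT)]

lemma abs_le (hB : 0 ≤ B) {B₀ t x : ℝ} (hB₀ : |u (0, x)| ≤ B₀) (ht : t ∈ Ico 0 T) :
    |u (t, x)| ≤ B₀ + B * T := by
  have hlip := (convex_Ico 0 T).norm_image_sub_le_of_norm_hasDerivWithin_le
    (f := fun s => u (s, x)) (f' := fun s => w (s, x))
    (fun s hs => (hasDerivAt_slice_fst (hu _ (mk_mem_timeSlab hs x))).hasDerivWithinAt)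
    (fun s hs => h.abs_w_le _ (mk_mem_timeSlab hs x))
    (left_mem_Ico.2 (ht.1.trans_lt ht.2)) ht
  rw [Real.norm_eq_abs, Real.norm_eq_abs, sub_zero, abs_of_nonneg ht.1] at hlip
  have htri := abs_sub_abs_le_abs_sub (u (t, x)) (u (0, x))
  have htT : B * t ≤ B * T := mul_le_mul_of_nonneg_left ht.2.le hB
  linarith

lemma size_le {B₀ t : ℝ} (ht : t ∈ Ico 0 T) (huB : ∀ x, |u (t, x)| ≤ B₀) :
    size c (Function.curry u) t ≤ ENNReal.ofReal B₀ + 5 * ENNReal.ofReal B + 2 := by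
  have hmem := mk_mem_timeSlab ht
  have hsum : ENNReal.ofReal B₀ + 5 * ENNReal.ofReal B + 2 =
      ENNReal.ofReal B₀ + ENNReal.ofReal B + ENNReal.ofReal B + ENNReal.ofReal B +
        ENNReal.ofReal B + ENNReal.ofReal B + 2 := by ring
  rw [size, dt_eq hu ht, dx_eq hu ht, h.dt_dt_eq hu ht, h.dx_dt_eq hu ht, h.dx_dx_eq hu ht, hsum]
  gcongr
  · exact eLpNorm_top_le_of_abs_le huB
  · exact eLpNorm_top_le_of_abs_le fun x => h.abs_w_le _ (hmem x)
  · exact eLpNorm_top_le_of_abs_le fun x => h.abs_V_le _ (hmem x)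
  · exact eLpNorm_top_le_of_abs_le fun x => h.abs_wt_le _ (hmem x)
  · exact eLpNorm_top_le_of_abs_le fun x => h.abs_wx_le _ (hmem x)
  · exact eLpNorm_top_le_of_abs_le fun x => h.abs_Vx_le _ (hmem x)
  · rw [eLpNorm_exponent_top]
    refine eLpNormEssSup_le_of_ae_enorm_bound (.of_forall fun x => ?_)
    rw [enorm_eq_self]
    exact enorm_inv_le_two (h.half_le_speed _ (hmem x))

omit hu

theorem le_lifespan (hT : 0 < T) {U : Set ℝ} (hU : ∀ q ∈ timeSlab T, V q ∈ U) {u₀ u₁ : ℝ → ℝ}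
    (hu₀ : ∀ x, HasDerivAt u₀ (V (0, x)) x) (hu₁ : ∀ x, w (0, x) = u₁ x) {B₀ : ℝ}
    (hB₀ : ∀ x, |u₀ x| ≤ B₀) : ENNReal.ofReal T ≤ lifespan U c u₀ u₁ := by
  obtain ⟨u, hu0, hu⟩ := h.exists_hasFDerivAt hT hu₀
  have hB : 0 ≤ B :=
    (abs_nonneg _).trans (h.abs_w_le _ (mk_mem_timeSlab (left_mem_Ico.2 hT) 0))
  obtain rfl : (fun x => u (0, x)) = u₀ := funext hu0
  obtain rfl : (fun x => w (0, x)) = u₁ := funext hu₁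
  refine le_sSup ⟨T, hT, rfl, Function.curry u, h.isClassicalSolution hu hU hT, ?_⟩
  have hsize (t : ℝ) (ht : t ∈ Ico 0 T) : size c (Function.curry u) t ≤
      ENNReal.ofReal (B₀ + B * T) + 5 * ENNReal.ofReal B + 2 :=
    h.size_le hu ht fun x => h.abs_le hu hB (hB₀ x) ht
  exact (iSup₂_le hsize).trans_lt (by simp [ENNReal.add_lt_top, ENNReal.mul_lt_top])

end IsSystemSolution

end FirstOrderSystem

section RiemannInvariants

/-- Data prescribed by the Riemann invariants `r = u_t + C(u_x)` and `s = u_t - C(u_x)`, where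
`C' = c`. The invariants are functions of the first and of the second characteristic label
respectively, and `v` is the slope `u_x = C⁻¹((r - s) / 2)` as a function of both labels. -/
structure RiemannData (c r s : ℝ → ℝ) (v : ℝ × ℝ → ℝ) (B : ℝ) : Prop where
  contDiff_left : ContDiff ℝ 1 r
  contDiff_right : ContDiff ℝ 1 s
  contDiff_speed : ContDiff ℝ 1 (c ∘ v)
  hasFDerivAt_slope : ∀ z,
    HasFDerivAt v (covector (deriv r z.1 / (2 * c (v z))) (-deriv s z.2 / (2 * c (v z)))) z
  abs_left_le : ∀ a, |r a| ≤ B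
  abs_right_le : ∀ b, |s b| ≤ B
  abs_deriv_left_le : ∀ a, |deriv r a| ≤ B
  abs_deriv_right_le : ∀ b, |deriv s b| ≤ B
  abs_slope_le : ∀ z, |v z| ≤ 2 * B
  abs_speed_sub_one_le : ∀ z, |c (v z) - 1| ≤ 1 / 10

namespace RiemannData

variable {c r s : ℝ → ℝ} {v : ℝ × ℝ → ℝ} {B T : ℝ} {Z : ℝ × ℝ → ℝ × ℝ} {ax bx : ℝ × ℝ → ℝ}

lemma speed_mem_Icc (h : RiemannData c r s v B) (z : ℝ × ℝ) : c (v z) ∈ Icc (9 / 10) (11 / 10) := by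
  obtain ⟨h₁, h₂⟩ := abs_le.1 (h.abs_speed_sub_one_le z)
  constructor <;> linarith

lemma speed_ne_zero (h : RiemannData c r s v B) (z : ℝ × ℝ) : c (v z) ≠ 0 := by
  linarith [(h.speed_mem_Icc z).1]

lemma hasFDerivAt_velocity (h : RiemannData c r s v B)
    (hZ : IsCharacteristicLabel (c ∘ v) T Z ax bx) {q : ℝ × ℝ} (hq : q ∈ timeSlab T) :
    HasFDerivAt (fun q => (r (Z q).1 + s (Z q).2) / 2)
      (covector (c (v (Z q)) * (deriv r (Z q).1 * ax q - deriv s (Z q).2 * bx q) / 2)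
        ((deriv r (Z q).1 * ax q + deriv s (Z q).2 * bx q) / 2)) q := by
  have hr := (h.contDiff_left.differentiable one_ne_zero (Z q).1).hasDerivAt
  have hs := (h.contDiff_right.differentiable one_ne_zero (Z q).2).hasDerivAt
  have hZq := hZ.hasFDerivAt q hq
  refine (((hr.comp_hasFDerivAt q hZq.fst).add (hs.comp_hasFDerivAt q hZq.snd)).mul_const
    2⁻¹).congr_fderiv ?_
  ext <;> simp <;> ring

lemma hasFDerivAt_slope_comp (h : RiemannData c r s v B)
    (hZ : IsCharacteristicLabel (c ∘ v) T Z ax bx) {q : ℝ × ℝ} (hq : q ∈ timeSlab T) :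
    HasFDerivAt (v ∘ Z)
      (covector ((deriv r (Z q).1 * ax q + deriv s (Z q).2 * bx q) / 2)
        ((deriv r (Z q).1 * ax q - deriv s (Z q).2 * bx q) / (2 * c (v (Z q))))) q := by
  refine ((h.hasFDerivAt_slope (Z q)).comp q (hZ.hasFDerivAt q hq)).congr_fderiv ?_
  have hc := h.speed_ne_zero (Z q)
  ext <;> simp <;> field_simp
  ring

lemma continuousOn_left_gradient (h : RiemannData c r s v B)
    (hZ : IsCharacteristicLabel (c ∘ v) T Z ax bx) :
    ContinuousOn (fun q => deriv r (Z q).1 * ax q) (timeSlab T) :=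
  ((h.contDiff_left.continuous_deriv le_rfl).comp_continuousOn hZ.continuousOn.fst).mul
    hZ.continuousOn_ax

lemma continuousOn_right_gradient (h : RiemannData c r s v B)
    (hZ : IsCharacteristicLabel (c ∘ v) T Z ax bx) :
    ContinuousOn (fun q => deriv s (Z q).2 * bx q) (timeSlab T) :=
  ((h.contDiff_right.continuous_deriv le_rfl).comp_continuousOn hZ.continuousOn.snd).mul
    hZ.continuousOn_bx

lemma abs_left_gradient_le (h : RiemannData c r s v B)
    (hZ : IsCharacteristicLabel (c ∘ v) T Z ax bx) (q : ℝ × ℝ) :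
    |deriv r (Z q).1 * ax q| ≤ B * 2 := by
  rw [abs_mul]
  exact mul_le_mul (h.abs_deriv_left_le _) (hZ.abs_ax_le q) (abs_nonneg _)
    ((abs_nonneg _).trans (h.abs_left_le 0))

lemma abs_right_gradient_le (h : RiemannData c r s v B)
    (hZ : IsCharacteristicLabel (c ∘ v) T Z ax bx) (q : ℝ × ℝ) :
    |deriv s (Z q).2 * bx q| ≤ B * 2 := by
  rw [abs_mul]
  exact mul_le_mul (h.abs_deriv_right_le _) (hZ.abs_bx_le q) (abs_nonneg _)
    ((abs_nonneg _).trans (h.abs_left_le 0))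

lemma abs_gradient_sub_le (h : RiemannData c r s v B)
    (hZ : IsCharacteristicLabel (c ∘ v) T Z ax bx) (q : ℝ × ℝ) :
    |deriv r (Z q).1 * ax q - deriv s (Z q).2 * bx q| ≤ 4 * B :=
  (abs_sub _ _).trans (by linarith [h.abs_left_gradient_le hZ q, h.abs_right_gradient_le hZ q])

theorem isSystemSolution (h : RiemannData c r s v B)
    (hZ : IsCharacteristicLabel (c ∘ v) T Z ax bx) :
    IsSystemSolution c T (4 * B) (fun q => (r (Z q).1 + s (Z q).2) / 2) (v ∘ Z)
      (fun q => c (v (Z q)) * (deriv r (Z q).1 * ax q - deriv s (Z q).2 * bx q) / 2)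
      (fun q => (deriv r (Z q).1 * ax q + deriv s (Z q).2 * bx q) / 2)
      (fun q => (deriv r (Z q).1 * ax q - deriv s (Z q).2 * bx q) / (2 * c (v (Z q)))) where
  hasFDerivAt_w _ hq := h.hasFDerivAt_velocity hZ hq
  hasFDerivAt_V _ hq := h.hasFDerivAt_slope_comp hZ hq
  continuousOn_wt := ((h.contDiff_speed.continuous.comp_continuousOn hZ.continuousOn).mul
    ((h.continuousOn_left_gradient hZ).sub (h.continuousOn_right_gradient hZ))).div_const 2
  continuousOn_wx :=
    ((h.continuousOn_left_gradient hZ).add (h.continuousOn_right_gradient hZ)).div_const 2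
  continuousOn_Vx := ((h.continuousOn_left_gradient hZ).sub (h.continuousOn_right_gradient hZ)).div
    (continuousOn_const.mul (h.contDiff_speed.continuous.comp_continuousOn hZ.continuousOn))
    fun _ _ => mul_ne_zero two_ne_zero (h.speed_ne_zero _)
  wt_eq q _ := by
    have hne := h.speed_ne_zero (Z q)
    simp only [Function.comp_apply]
    field_simp
  half_le_speed q _ := le_trans (by norm_num) (h.speed_mem_Icc (Z q)).1
  abs_w_le q _ := by
    rw [abs_div, abs_two]
    linarith [abs_add_le (r (Z q).1) (s (Z q).2), h.abs_left_le (Z q).1, h.abs_right_le (Z q).2,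
      abs_nonneg (r (Z q).1)]
  abs_V_le q _ := (h.abs_slope_le (Z q)).trans
    (by linarith [(abs_nonneg _).trans (h.abs_left_le 0)])
  abs_wt_le q _ := by
    obtain ⟨hlower, hupper⟩ := h.speed_mem_Icc (Z q)
    rw [abs_div, abs_two, abs_mul, abs_of_pos (by linarith)]
    nlinarith [h.abs_gradient_sub_le hZ q, (abs_nonneg _).trans (h.abs_gradient_sub_le hZ q)]
  abs_wx_le q _ := by
    rw [abs_div, abs_two]
    linarith [abs_add_le (deriv r (Z q).1 * ax q) (deriv s (Z q).2 * bx q),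
      h.abs_left_gradient_le hZ q, h.abs_right_gradient_le hZ q,
      abs_nonneg (deriv r (Z q).1 * ax q)]
  abs_Vx_le q _ := by
    have hpos : 1 ≤ 2 * c (v (Z q)) := by linarith [(h.speed_mem_Icc (Z q)).1]
    rw [abs_div, abs_of_pos (a := 2 * _) (by linarith)]
    exact (div_le_self (abs_nonneg _) hpos).trans (h.abs_gradient_sub_le hZ q)

lemma norm_fderiv_speed_le (h : RiemannData c r s v B) {z : ℝ × ℝ}
    (hc : DifferentiableAt ℝ c (v z)) : ‖fderiv ℝ (c ∘ v) z‖ ≤ |deriv c (v z)| * (2 * B) := by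
  have hpos : 1 ≤ 2 * c (v z) := by linarith [(h.speed_mem_Icc z).1]
  have hcoef {e : ℝ} (he : |e| ≤ B) : |e / (2 * c (v z))| ≤ B := by
    rw [abs_div, abs_of_pos (a := 2 * _) (by linarith)]
    exact (div_le_self (abs_nonneg _) hpos).trans he
  rw [(hc.hasDerivAt.comp_hasFDerivAt z (h.hasFDerivAt_slope z)).fderiv, norm_smul,
    Real.norm_eq_abs]
  refine mul_le_mul_of_nonneg_left ((norm_covector_le _ _).trans ?_) (abs_nonneg _)
  linarith [hcoef (h.abs_deriv_left_le z.1),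
    hcoef (e := -deriv s z.2) (by rw [abs_neg]; exact h.abs_deriv_right_le z.2)]

theorem le_lifespan (h : RiemannData c r s v B) {κ : ℝ} (hκ : ∀ z, ‖fderiv ℝ (c ∘ v) z‖ ≤ κ)
    (hT : 0 < T) (hκT : 360 * κ * T ≤ 1) {U : Set ℝ} (hU : ∀ z, v z ∈ U) {u₀ u₁ : ℝ → ℝ}
    (hu₀ : ∀ x, HasDerivAt u₀ (v (x, x)) x) (hu₁ : ∀ x, u₁ x = (r x + s x) / 2) {B₀ : ℝ}
    (hB₀ : ∀ x, |u₀ x| ≤ B₀) : ENNReal.ofReal T ≤ lifespan U c u₀ u₁ := by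
  obtain ⟨Z, ax, bx, hZ⟩ :=
    exists_isCharacteristicLabel h.contDiff_speed h.abs_speed_sub_one_le hκ hT hκT
  refine (h.isSystemSolution hZ).le_lifespan hT (fun q _ => hU _) (fun x => ?_) (fun x => ?_) hB₀
  · simpa only [Function.comp_apply, hZ.initial] using hu₀ x
  · rw [hZ.initial, hu₁]

end RiemannData

end RiemannInvariants

section SpeedChart

lemma exists_local_inverse {f f' : ℝ → ℝ} {a : ℝ} (hf : ∀ᶠ x in 𝓝 a, HasDerivAt f (f' x) x)
    (hf' : ContinuousAt f' a) (ha : f' a ≠ 0) :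
    ∃ g : ℝ → ℝ, ContinuousAt g (f a) ∧ (∀ᶠ x in 𝓝 a, g (f x) = x) ∧
      ∀ᶠ y in 𝓝 (f a), HasDerivAt g (f' (g y))⁻¹ y := by
  have hstrict := (hasStrictDerivAt_of_hasDerivAt_of_continuousAt hf hf').hasStrictFDerivAt_equiv ha
  let e := hstrict.toOpenPartialHomeomorph f
  have hsource : a ∈ e.source := hstrict.mem_toOpenPartialHomeomorph_source
  have htarget : f a ∈ e.target := e.map_source hsource
  have hcont : Tendsto e.symm (𝓝 (f a)) (𝓝 a) := by
    simpa only [ContinuousAt, show e.symm (f a) = a from e.left_inv hsource] using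
      e.symm.continuousAt htarget
  refine ⟨e.symm, e.symm.continuousAt htarget, e.eventually_left_inverse hsource, ?_⟩
  filter_upwards [e.open_target.eventually_mem htarget, hcont.eventually hf,
    hcont.eventually (hf'.eventually_ne ha)] with y hy hfy hne
  exact e.hasDerivAt_symm hy hne hfy

lemma exists_primitive {f : ℝ → ℝ} {a : ℝ} (hf : ∀ᶠ x in 𝓝 a, ContinuousAt f x) :
    ∃ F : ℝ → ℝ, F a = 0 ∧ ∀ᶠ x in 𝓝 a, HasDerivAt F (f x) x := by
  obtain ⟨δ, hδ, hball⟩ := Metric.eventually_nhds_iff_ball.1 hf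
  have hcont : ContinuousOn f (Metric.ball a δ) := fun x hx => (hball x hx).continuousWithinAt
  refine ⟨fun x => ∫ y in a..x, f y, intervalIntegral.integral_same, ?_⟩
  filter_upwards [Metric.ball_mem_nhds a hδ] with x hx
  refine intervalIntegral.integral_hasDerivAt_right ?_
    (hcont.stronglyMeasurableAtFilter Metric.isOpen_ball x hx) (hball x hx)
  have hsub : uIcc a x ⊆ Metric.ball a δ :=
    (convex_ball a δ).ordConnected.uIcc_subset (Metric.mem_ball_self hδ) hx
  exact (hcont.mono hsub).intervalIntegrable

lemma eventually_abs_le_two_mul_abs {f : ℝ → ℝ} (hf : HasDerivAt f 1 0) (h0 : f 0 = 0) :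
    ∀ᶠ x in 𝓝 0, |f x| ≤ 2 * |x| := by
  filter_upwards [hf.isLittleO.bound one_pos] with x hx
  simp only [h0, sub_zero, smul_eq_mul, mul_one, one_mul, Real.norm_eq_abs] at hx
  linarith [abs_sub_abs_le_abs_sub (f x) x]

/-- The slope `θ` lies in the domain `U` of the speed `c`, and near it `c` is continuously
differentiable, close to `1` and has derivative at most `K |θ|^q`. -/
structure IsAdmissibleSlope (U : Set ℝ) (c : ℝ → ℝ) (q K θ : ℝ) : Prop where
  mem_domain : θ ∈ U
  contDiffAt : ContDiffAt ℝ 1 c θ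
  abs_speed_sub_one_le : |c θ - 1| ≤ 1 / 10
  abs_deriv_speed_le : |deriv c θ| ≤ K * |θ| ^ q

lemma IsAdmissibleSlope.speed_ne_zero {U : Set ℝ} {c : ℝ → ℝ} {q K θ : ℝ}
    (h : IsAdmissibleSlope U c q K θ) : c θ ≠ 0 := by
  linarith [(abs_le.1 h.abs_speed_sub_one_le).1]

/-- On `(-δ, δ)` the function `C` is a primitive of the speed `c` with `C 0 = 0`, and `Y` is its
inverse; the Riemann invariants of a solution are `u_t ± C(u_x)`. -/
structure SpeedChart (U : Set ℝ) (c : ℝ → ℝ) (q K : ℝ) (C Y : ℝ → ℝ) (δ : ℝ) : Prop where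
  admissible : ∀ θ, |θ| < δ → IsAdmissibleSlope U c q K θ
  hasDerivAt_primitive : ∀ θ, |θ| < δ → HasDerivAt C (c θ) θ
  abs_primitive_le : ∀ θ, |θ| < δ → |C θ| ≤ 2 * |θ|
  inverse_primitive : ∀ θ, |θ| < δ → Y (C θ) = θ
  admissible_inverse : ∀ y, |y| < δ → IsAdmissibleSlope U c q K (Y y)
  hasDerivAt_inverse : ∀ y, |y| < δ → HasDerivAt Y (c (Y y))⁻¹ y
  abs_inverse_le : ∀ y, |y| < δ → |Y y| ≤ 2 * |y|

lemma eventually_isAdmissibleSlope {U : Set ℝ} (hU : U ∈ 𝓝 0) {c : ℝ → ℝ} (hc0 : c 0 = 1)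
    (hc : ContDiffAt ℝ 1 c 0) {q K : ℝ} (hK : ∀ᶠ θ in 𝓝 0, |deriv c θ| ≤ K * |θ| ^ q) :
    ∀ᶠ θ in 𝓝 0, IsAdmissibleSlope U c q K θ := by
  have hnear := hc.continuousAt.eventually_mem (Metric.closedBall_mem_nhds (c 0)
    (by norm_num : (0 : ℝ) < 1 / 10))
  filter_upwards [hU, hc.eventually (by simp), hnear, hK] with θ hθU hθc hθ hθK
  exact ⟨hθU, hθc, by simpa [hc0, Real.dist_eq] using hθ, hθK⟩

theorem exists_speedChart {U : Set ℝ} {c : ℝ → ℝ} (hc0 : c 0 = 1) {q K : ℝ}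
    (hadm : ∀ᶠ θ in 𝓝 0, IsAdmissibleSlope U c q K θ) :
    ∃ C Y δ, 0 < δ ∧ SpeedChart U c q K C Y δ := by
  have hcont : ContinuousAt c 0 := hadm.self_of_nhds.contDiffAt.continuousAt
  obtain ⟨C, hC0, hC⟩ := exists_primitive (hadm.mono fun θ hθ => hθ.contDiffAt.continuousAt)
  obtain ⟨Y, hYcont, hYC, hY⟩ := exists_local_inverse hC hcont (by rw [hc0]; exact one_ne_zero)
  have hY0 : Y 0 = 0 := by simpa only [hC0] using hYC.self_of_nhds
  rw [hC0] at hYcont hY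
  have hYtendsto : Tendsto Y (𝓝 0) (𝓝 0) := by simpa only [ContinuousAt, hY0] using hYcont
  have hC' : HasDerivAt C 1 0 := hc0 ▸ hC.self_of_nhds
  have hY' : HasDerivAt Y 1 0 := by simpa only [hY0, hc0, inv_one] using hY.self_of_nhds
  obtain ⟨δ, hδ, h⟩ := Metric.eventually_nhds_iff.1 (hadm.and (hC.and
    ((eventually_abs_le_two_mul_abs hC' hC0).and (hYC.and ((hYtendsto.eventually hadm).and
      (hY.and (eventually_abs_le_two_mul_abs hY' hY0)))))))
  simp only [Real.dist_eq, sub_zero] at h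
  exact ⟨C, Y, δ, hδ, fun θ hθ => (h hθ).1, fun θ hθ => (h hθ).2.1, fun θ hθ => (h hθ).2.2.1,
    fun θ hθ => (h hθ).2.2.2.1, fun y hy => (h hy).2.2.2.2.1, fun y hy => (h hy).2.2.2.2.2.1,
    fun y hy => (h hy).2.2.2.2.2.2⟩

lemma abs_half_sub_le {x y B : ℝ} (hx : |x| ≤ B) (hy : |y| ≤ B) : |(x - y) / 2| ≤ B := by
  rw [abs_div, abs_two]
  linarith [abs_sub x y]

/-- The slope `C⁻¹((r - s) / 2)` with Riemann invariants `r` and `s`, as a function of the two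
characteristic labels; `Y` stands for `C⁻¹`. -/
noncomputable def riemannSlope (Y r s : ℝ → ℝ) (z : ℝ × ℝ) : ℝ := Y ((r z.1 - s z.2) / 2)

/-- The initial position `u₀` is `C²` and bounded, the initial velocity `u₁` is `C¹`, and
`u₀'`, `u₀''`, `u₁`, `u₁'` are bounded by `μ`. -/
structure IsSmallData (u₀ u₁ : ℝ → ℝ) (μ : ℝ) : Prop where
  differentiable_pos : Differentiable ℝ u₀
  contDiff_slope : ContDiff ℝ 1 (deriv u₀)
  contDiff_vel : ContDiff ℝ 1 u₁
  exists_abs_pos_le : ∃ B₀, ∀ x, |u₀ x| ≤ B₀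
  abs_slope_le : ∀ x, |deriv u₀ x| ≤ μ
  abs_deriv_slope_le : ∀ x, |deriv (deriv u₀) x| ≤ μ
  abs_vel_le : ∀ x, |u₁ x| ≤ μ
  abs_deriv_vel_le : ∀ x, |deriv u₁ x| ≤ μ

namespace SpeedChart

variable {U : Set ℝ} {c : ℝ → ℝ} {q K : ℝ} {C Y : ℝ → ℝ} {δ : ℝ}

lemma hasDerivAt_primitive_comp (h : SpeedChart U c q K C Y δ) {g : ℝ → ℝ}
    (hg : Differentiable ℝ g) {x : ℝ} (hx : |g x| < δ) :
    HasDerivAt (C ∘ g) (c (g x) * deriv g x) x :=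
  (h.hasDerivAt_primitive _ hx).comp x (hg x).hasDerivAt

lemma contDiff_primitive_comp (h : SpeedChart U c q K C Y δ) {g : ℝ → ℝ} (hg : ContDiff ℝ 1 g)
    (hgδ : ∀ x, |g x| < δ) : ContDiff ℝ 1 (C ∘ g) := by
  have hd (x : ℝ) := h.hasDerivAt_primitive_comp (hg.differentiable one_ne_zero) (hgδ x)
  have hcg : Continuous fun x => c (g x) := continuous_iff_continuousAt.2 fun x =>
    (h.admissible _ (hgδ x)).contDiffAt.continuousAt.comp hg.continuous.continuousAt
  rw [contDiff_one_iff_deriv]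
  refine ⟨fun x => (hd x).differentiableAt, ?_⟩
  rw [funext fun x => (hd x).deriv]
  exact hcg.mul (hg.continuous_deriv le_rfl)

lemma abs_deriv_primitive_comp_le (h : SpeedChart U c q K C Y δ) {g : ℝ → ℝ}
    (hg : Differentiable ℝ g) {x : ℝ} (hx : |g x| < δ) :
    |deriv (C ∘ g) x| ≤ 2 * |deriv g x| := by
  have hc : |c (g x)| ≤ 2 := by
    have h1 := (h.admissible _ hx).abs_speed_sub_one_le
    rw [abs_le] at h1 ⊢
    constructor <;> linarith
  rw [(h.hasDerivAt_primitive_comp hg hx).deriv, abs_mul]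
  exact mul_le_mul_of_nonneg_right hc (abs_nonneg _)

lemma hasFDerivAt_riemannSlope (h : SpeedChart U c q K C Y δ) {r s : ℝ → ℝ}
    (hr : Differentiable ℝ r) (hs : Differentiable ℝ s) {z : ℝ × ℝ}
    (hz : |(r z.1 - s z.2) / 2| < δ) :
    HasFDerivAt (riemannSlope Y r s)
      (covector (deriv r z.1 / (2 * c (riemannSlope Y r s z)))
        (-deriv s z.2 / (2 * c (riemannSlope Y r s z)))) z := by
  have hrz := (hr z.1).hasDerivAt.comp_hasFDerivAt z (hasFDerivAt_fst (𝕜 := ℝ))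
  have hsz := (hs z.2).hasDerivAt.comp_hasFDerivAt z (hasFDerivAt_snd (𝕜 := ℝ))
  refine ((h.hasDerivAt_inverse _ hz).comp_hasFDerivAt z
    ((hrz.sub hsz).mul_const 2⁻¹)).congr_fderiv ?_
  have hne := (h.admissible_inverse _ hz).speed_ne_zero
  ext <;> simp [riemannSlope] <;> field_simp

lemma contDiff_riemannSlope (h : SpeedChart U c q K C Y δ) {r s : ℝ → ℝ}
    (hr : ContDiff ℝ 1 r) (hs : ContDiff ℝ 1 s) (hδ : ∀ z : ℝ × ℝ, |(r z.1 - s z.2) / 2| < δ) :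
    ContDiff ℝ 1 (riemannSlope Y r s) := by
  have hv (z : ℝ × ℝ) := h.hasFDerivAt_riemannSlope (hr.differentiable one_ne_zero)
    (hs.differentiable one_ne_zero) (hδ z)
  have hadm (z : ℝ × ℝ) : IsAdmissibleSlope U c q K (riemannSlope Y r s z) :=
    h.admissible_inverse _ (hδ z)
  have hcv : Continuous fun z => c (riemannSlope Y r s z) := continuous_iff_continuousAt.2 fun z =>
    (hadm z).contDiffAt.continuousAt.comp (hv z).continuousAt
  have hne (z : ℝ × ℝ) : 2 * c (riemannSlope Y r s z) ≠ 0 :=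
    mul_ne_zero two_ne_zero (hadm z).speed_ne_zero
  exact contDiff_one_of_hasFDerivAt_covector
    (((hr.continuous_deriv le_rfl).comp continuous_fst).div (continuous_const.mul hcv) hne)
    (((hs.continuous_deriv le_rfl).comp continuous_snd).neg.div (continuous_const.mul hcv) hne) hv

lemma riemannData (h : SpeedChart U c q K C Y δ) {r s : ℝ → ℝ} {B : ℝ} (hB : B < δ)
    (hr : ContDiff ℝ 1 r) (hs : ContDiff ℝ 1 s) (hrB : ∀ a, |r a| ≤ B) (hsB : ∀ b, |s b| ≤ B)
    (hrB' : ∀ a, |deriv r a| ≤ B) (hsB' : ∀ b, |deriv s b| ≤ B) :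
    RiemannData c r s (riemannSlope Y r s) B := by
  have hy (z : ℝ × ℝ) : |(r z.1 - s z.2) / 2| ≤ B := abs_half_sub_le (hrB z.1) (hsB z.2)
  have hδ (z : ℝ × ℝ) : |(r z.1 - s z.2) / 2| < δ := (hy z).trans_lt hB
  have hadm (z : ℝ × ℝ) : IsAdmissibleSlope U c q K (riemannSlope Y r s z) :=
    h.admissible_inverse _ (hδ z)
  exact {
    contDiff_left := hr
    contDiff_right := hs
    contDiff_speed := contDiff_iff_contDiffAt.2 fun z =>
      (hadm z).contDiffAt.comp z (h.contDiff_riemannSlope hr hs hδ).contDiffAt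
    hasFDerivAt_slope := fun z => h.hasFDerivAt_riemannSlope (hr.differentiable one_ne_zero)
      (hs.differentiable one_ne_zero) (hδ z)
    abs_left_le := hrB
    abs_right_le := hsB
    abs_deriv_left_le := hrB'
    abs_deriv_right_le := hsB'
    abs_slope_le := fun z => (h.abs_inverse_le _ (hδ z)).trans (by linarith [hy z])
    abs_speed_sub_one_le := fun z => (hadm z).abs_speed_sub_one_le }

lemma riemannData_of_isSmallData (h : SpeedChart U c q K C Y δ) {u₀ u₁ : ℝ → ℝ} {μ : ℝ}
    (hu : IsSmallData u₀ u₁ μ) (hμ : 3 * μ < δ) :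
    RiemannData c (u₁ + C ∘ deriv u₀) (u₁ - C ∘ deriv u₀)
      (riemannSlope Y (u₁ + C ∘ deriv u₀) (u₁ - C ∘ deriv u₀)) (3 * μ) := by
  have hμ0 : 0 ≤ μ := (abs_nonneg _).trans (hu.abs_vel_le 0)
  have hδ (x : ℝ) : |deriv u₀ x| < δ := (hu.abs_slope_le x).trans_lt (by linarith)
  have hslope := hu.contDiff_slope.differentiable one_ne_zero
  have hC1 := h.contDiff_primitive_comp hu.contDiff_slope hδ
  have hd₁ := hu.contDiff_vel.differentiable one_ne_zero
  have hdC := hC1.differentiable one_ne_zero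
  have hC (x : ℝ) : |(C ∘ deriv u₀) x| ≤ 2 * μ :=
    (h.abs_primitive_le _ (hδ x)).trans (by linarith [hu.abs_slope_le x])
  have hC' (x : ℝ) : |deriv (C ∘ deriv u₀) x| ≤ 2 * μ :=
    (h.abs_deriv_primitive_comp_le hslope (hδ x)).trans (by linarith [hu.abs_deriv_slope_le x])
  refine h.riemannData hμ (hu.contDiff_vel.add hC1) (hu.contDiff_vel.sub hC1)
    (fun x => (abs_add_le _ _).trans ?_) (fun x => (abs_sub _ _).trans ?_) (fun x => ?_)
    (fun x => ?_)
  · linarith [hu.abs_vel_le x, hC x]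
  · linarith [hu.abs_vel_le x, hC x]
  · rw [deriv_add (hd₁ x) (hdC x)]
    exact (abs_add_le _ _).trans (by linarith [hu.abs_deriv_vel_le x, hC' x])
  · rw [deriv_sub (hd₁ x) (hdC x)]
    exact (abs_sub _ _).trans (by linarith [hu.abs_deriv_vel_le x, hC' x])

theorem le_lifespan (h : SpeedChart U c q K C Y δ) (hq : 0 ≤ q) (hK : 0 < K) {u₀ u₁ : ℝ → ℝ}
    {μ : ℝ} (hμ : 0 < μ) (hu : IsSmallData u₀ u₁ μ) (hμδ : 3 * μ < δ) :
    ENNReal.ofReal ((6 * μ) ^ (-(q + 1)) / (360 * K)) ≤ lifespan U c u₀ u₁ := by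
  set r := u₁ + C ∘ deriv u₀ with hr
  set s := u₁ - C ∘ deriv u₀ with hs
  have hR : RiemannData c r s (riemannSlope Y r s) (3 * μ) := h.riemannData_of_isSmallData hu hμδ
  have hδ (x : ℝ) : |deriv u₀ x| < δ := (hu.abs_slope_le x).trans_lt (by linarith)
  have hy (z : ℝ × ℝ) : |(r z.1 - s z.2) / 2| < δ :=
    (abs_half_sub_le (hR.abs_left_le z.1) (hR.abs_right_le z.2)).trans_lt hμδ
  have hdiag (x : ℝ) : riemannSlope Y r s (x, x) = deriv u₀ x := by
    rw [riemannSlope, ← h.inverse_primitive _ (hδ x)]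
    congr 1
    simp only [hr, hs, Pi.add_apply, Pi.sub_apply, Function.comp_apply]
    ring
  have hκ (z : ℝ × ℝ) : ‖fderiv ℝ (c ∘ riemannSlope Y r s) z‖ ≤ K * (6 * μ) ^ (q + 1) := by
    have hadm := h.admissible_inverse _ (hy z)
    calc ‖fderiv ℝ (c ∘ riemannSlope Y r s) z‖
        ≤ |deriv c (riemannSlope Y r s z)| * (2 * (3 * μ)) :=
          hR.norm_fderiv_speed_le (hadm.contDiffAt.differentiableAt one_ne_zero)
      _ ≤ (K * |riemannSlope Y r s z| ^ q) * (2 * (3 * μ)) := by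
          gcongr
          exact hadm.abs_deriv_speed_le
      _ ≤ (K * (2 * (3 * μ)) ^ q) * (2 * (3 * μ)) := by
          gcongr
          exact hR.abs_slope_le z
      _ = K * (6 * μ) ^ (q + 1) := by
          rw [Real.rpow_add_one (by positivity)]
          ring_nf
  obtain ⟨B₀, hB₀⟩ := hu.exists_abs_pos_le
  refine hR.le_lifespan hκ (by positivity) (le_of_eq ?_)
    (fun z => (h.admissible_inverse _ (hy z)).mem_domain) (fun x => ?_) (fun x => ?_) hB₀
  · rw [Real.rpow_neg (by positivity)]
    field_simp
  · rw [hdiag]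
    exact (hu.differentiable_pos x).hasDerivAt
  · simp only [hr, hs, Pi.add_apply, Pi.sub_apply]
    ring

end SpeedChart

end SpeedChart

section LifespanBounds

lemma IsCb.exists_isSmallData {φ ψ : ℝ → ℝ} (hφ : IsCb 2 φ) (hψ : IsCb 1 ψ) :
    ∃ M, 0 < M ∧ IsSmallData φ ψ M := by
  obtain ⟨B₀, hB₀⟩ := hφ.2 0 zero_le_two
  obtain ⟨B₁, hB₁⟩ := hφ.2 1 one_le_two
  obtain ⟨B₂, hB₂⟩ := hφ.2 2 le_rfl
  obtain ⟨D₀, hD₀⟩ := hψ.2 0 zero_le_one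
  obtain ⟨D₁, hD₁⟩ := hψ.2 1 le_rfl
  simp only [iteratedDeriv_succ, iteratedDeriv_zero] at hB₀ hB₁ hB₂ hD₀ hD₁
  have hφ2 : ContDiff ℝ (1 + 1) φ := by simpa only [Nat.cast_ofNat, one_add_one_eq_two] using hφ.1
  rw [contDiff_succ_iff_deriv] at hφ2
  obtain ⟨M, hM⟩ := (Set.toFinite {B₁, B₂, D₀, D₁, 1}).bddAbove
  simp only [mem_upperBounds, mem_insert_iff, mem_singleton_iff, forall_eq_or_imp, forall_eq] at hM
  obtain ⟨h₁, h₂, h₃, h₄, h₅⟩ := hM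
  exact ⟨M, one_pos.trans_le h₅, {
    differentiable_pos := hφ2.1
    contDiff_slope := hφ2.2.2
    contDiff_vel := by simpa only [Nat.cast_one] using hψ.1
    exists_abs_pos_le := ⟨B₀, hB₀⟩
    abs_slope_le := fun x => (hB₁ x).trans h₁
    abs_deriv_slope_le := fun x => (hB₂ x).trans h₂
    abs_vel_le := fun x => (hD₀ x).trans h₃
    abs_deriv_vel_le := fun x => (hD₁ x).trans h₄ }⟩

lemma IsSmallData.const_mul {u₀ u₁ : ℝ → ℝ} {μ : ℝ} (h : IsSmallData u₀ u₁ μ) {ε : ℝ}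
    (hε : 0 < ε) : IsSmallData (fun x => ε * u₀ x) (fun x => ε * u₁ x) (ε * μ) := by
  have habs {y B : ℝ} (hy : |y| ≤ B) : |ε * y| ≤ ε * B := by
    rw [abs_mul, abs_of_pos hε]
    exact mul_le_mul_of_nonneg_left hy hε.le
  have hslope : deriv (fun x => ε * u₀ x) = fun x => ε * deriv u₀ x :=
    funext fun x => deriv_const_mul_field ε
  obtain ⟨B₀, hB₀⟩ := h.exists_abs_pos_le
  exact {
    differentiable_pos := h.differentiable_pos.const_mul ε
    contDiff_slope := hslope ▸ contDiff_const.mul h.contDiff_slope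
    contDiff_vel := contDiff_const.mul h.contDiff_vel
    exists_abs_pos_le := ⟨ε * B₀, fun x => habs (hB₀ x)⟩
    abs_slope_le := fun x => by
      rw [hslope]
      exact habs (h.abs_slope_le x)
    abs_deriv_slope_le := fun x => by
      rw [hslope, deriv_const_mul_field]
      exact habs (h.abs_deriv_slope_le x)
    abs_vel_le := fun x => habs (h.abs_vel_le x)
    abs_deriv_vel_le := fun x => by
      rw [deriv_const_mul_field]
      exact habs (h.abs_deriv_vel_le x) }

lemma norm_abs_rpow (x a : ℝ) : ‖|x| ^ a‖ = |x| ^ a :=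
  Real.norm_of_nonneg (Real.rpow_nonneg (abs_nonneg x) a)

lemma isBigO_rpow_add_one_of_hasDerivAt {f f' : ℝ → ℝ} (hf : ∀ᶠ x in 𝓝 0, HasDerivAt f (f' x) x)
    (h0 : f 0 = 0) {a : ℝ} (ha : 0 ≤ a) (h : f' =O[𝓝 0] fun x => |x| ^ a) :
    f =O[𝓝 0] fun x => |x| ^ (a + 1) := by
  obtain ⟨K, hK, hbound⟩ := h.exists_pos
  obtain ⟨δ, hδ, hnear⟩ := Metric.eventually_nhds_iff.1 (hf.and hbound.bound)
  refine IsBigO.of_bound K ?_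
  filter_upwards [Metric.ball_mem_nhds 0 hδ] with x hx
  have hle {y : ℝ} (hy : y ∈ uIcc 0 x) : |y| ≤ |x| := by simpa using abs_sub_left_of_mem_uIcc hy
  have hyδ {y : ℝ} (hy : y ∈ uIcc 0 x) : dist y 0 < δ := by
    simpa using (hle hy).trans_lt (by simpa using hx)
  have hderiv (y : ℝ) (hy : y ∈ uIcc 0 x) : ‖f' y‖ ≤ K * |x| ^ a := by
    refine (hnear (hyδ hy)).2.trans ?_
    rw [norm_abs_rpow]
    exact mul_le_mul_of_nonneg_left (Real.rpow_le_rpow (abs_nonneg y) (hle hy) ha) hK.le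
  have hmvt := (convex_uIcc 0 x).norm_image_sub_le_of_norm_hasDerivWithin_le
    (fun y hy => (hnear (hyδ hy)).1.hasDerivWithinAt) hderiv left_mem_uIcc right_mem_uIcc
  calc ‖f x‖ = ‖f x - f 0‖ := by rw [h0, sub_zero]
    _ ≤ K * |x| ^ a * ‖x - 0‖ := hmvt
    _ = K * ‖|x| ^ (a + 1)‖ := by
      rw [sub_zero, norm_abs_rpow, Real.rpow_add_one' (abs_nonneg x) (by positivity),
        Real.norm_eq_abs, mul_assoc]

lemma isBigO_rpow_of_iteratedDeriv {f : ℝ → ℝ} {n : ℕ} (hf : ContDiffAt ℝ n f 0)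
    (h0 : ∀ k < n, iteratedDeriv k f 0 = 0) {a : ℝ} (ha : 0 ≤ a)
    (h : iteratedDeriv n f =O[𝓝 0] fun x => |x| ^ a) : f =O[𝓝 0] fun x => |x| ^ (a + n) := by
  induction n generalizing f with
  | zero => simpa using h
  | succ n ih =>
    have hderiv : deriv f =O[𝓝 0] fun x => |x| ^ (a + n) := by
      refine ih (hf.derivWithin le_rfl) (fun k hk => ?_) ?_
      · simpa only [iteratedDeriv_succ'] using h0 (k + 1) (by omega)
      · simpa only [iteratedDeriv_succ'] using h
    have hdiff : ∀ᶠ x in 𝓝 0, HasDerivAt f (deriv f x) x :=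
      ((hf.of_le (by exact_mod_cast n.succ_pos)).eventually (by simp)).mono fun x hx =>
        (hx.differentiableAt one_ne_zero).hasDerivAt
    simpa only [Nat.cast_succ, add_assoc] using
      isBigO_rpow_add_one_of_hasDerivAt hdiff (h0 0 n.succ_pos) (by positivity) hderiv

lemma FlatSpeed.contDiffAt {p : ℝ} (hp : 2 < p) {U : Set ℝ} (hU : U ∈ 𝓝 0) {c : ℝ → ℝ}
    (h : FlatSpeed p U c) : ContDiffAt ℝ 1 c 0 :=
  (h.1.1.contDiffAt hU).of_le (by exact_mod_cast Nat.one_le_ceil_iff.2 (sub_pos.2 hp))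

lemma FlatSpeed.isBigO_deriv {p : ℝ} (hp : 2 < p) {U : Set ℝ} (hU : U ∈ 𝓝 0) {c : ℝ → ℝ}
    (h : FlatSpeed p U c) : deriv c =O[𝓝 0] fun θ => |θ| ^ (p - 2) := by
  obtain ⟨⟨hc, -⟩, hflat, K, -, hbound⟩ := h
  obtain ⟨n, hn⟩ := Nat.exists_eq_add_of_le' (Nat.one_le_ceil_iff.2 (sub_pos.2 hp))
  rw [hn] at hc hflat hbound
  have hceil : (⌈p - 1⌉ : ℝ) = n + 2 := by
    rw [show p - 1 = p - 2 + 1 by ring, Int.ceil_add_one,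
      ← Int.natCast_ceil_eq_ceil (sub_pos.2 hp).le, hn]
    push_cast
    ring
  have hγ : 0 ≤ p - ⌈p - 1⌉ := by linarith [Int.ceil_lt_add_one (p - 1)]
  have hbigO : iteratedDeriv n (deriv c) =O[𝓝 0] fun θ => |θ| ^ (p - ⌈p - 1⌉) := by
    rw [← iteratedDeriv_succ']
    refine IsBigO.of_bound K ?_
    filter_upwards [hU] with θ hθ
    rw [norm_abs_rpow, Real.norm_eq_abs]
    exact hbound θ hθ
  have hderiv : ContDiffAt ℝ n (deriv c) 0 := (hc.contDiffAt hU).derivWithin le_rfl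
  have h := isBigO_rpow_of_iteratedDeriv hderiv (fun k hk => ?_) hγ hbigO
  · rwa [hceil, show p - (n + 2 : ℝ) + n = p - 2 by ring] at h
  · rw [← iteratedDeriv_succ']
    exact hflat (k + 1) (by omega) (by omega)

end LifespanBounds

end QuasilinearWave

open Asymptotics Topology in
theorem theorem1_general {U : Set ℝ} (hU : U ∈ 𝓝 0) {c : ℝ → ℝ} (hc0 : c 0 = 1)
    (hc : ContDiffAt ℝ 1 c 0) {φ ψ : ℝ → ℝ} (hφ : QuasilinearWave.IsCb 2 φ)
    (hψ : QuasilinearWave.IsCb 1 ψ) {q : ℝ} (hq : 0 ≤ q)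
    (hderiv : deriv c =O[𝓝 0] fun θ => |θ| ^ q) :
    ∃ ε₀ : ℝ, 0 < ε₀ ∧ ∃ C : ℝ, 0 < C ∧ ∀ ε : ℝ, 0 < ε → ε ≤ ε₀ →
      ENNReal.ofReal (C * ε ^ (-(q + 1))) ≤
        QuasilinearWave.lifespan U c (fun x => ε * φ x) (fun x => ε * ψ x) := by
  obtain ⟨K, hK, hbound⟩ := hderiv.exists_pos
  have hcK : ∀ᶠ θ in 𝓝 0, |deriv c θ| ≤ K * |θ| ^ q := hbound.bound.mono fun θ hθ => by
    rwa [QuasilinearWave.norm_abs_rpow, Real.norm_eq_abs] at hθ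
  obtain ⟨C, Y, δ, hδ, hchart⟩ := QuasilinearWave.exists_speedChart hc0
    (QuasilinearWave.eventually_isAdmissibleSlope hU hc0 hc hcK)
  obtain ⟨M, hM, hdata⟩ := hφ.exists_isSmallData hψ
  refine ⟨δ / (4 * M), by positivity, (6 * M) ^ (-(q + 1)) / (360 * K), by positivity,
    fun ε hε hεδ => ?_⟩
  rw [le_div_iff₀ (by positivity)] at hεδ
  convert hchart.le_lifespan hq hK (mul_pos hε hM) (hdata.const_mul hε) (by linarith) using 2
  rw [mul_left_comm, Real.mul_rpow hε.le (by positivity)]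
  ring

theorem theorem1 (U : Set ℝ) (hU : IsOpen U) (h0U : (0 : ℝ) ∈ U)
    (c : ℝ → ℝ) (hc0 : c 0 = 1)
    (φ ψ : ℝ → ℝ) (hφ : QuasilinearWave.IsCb 2 φ) (hψ : QuasilinearWave.IsCb 1 ψ) :
    (∀ p : ℝ, 2 < p → QuasilinearWave.FlatSpeed p U c →
      ∃ ε₀ : ℝ, 0 < ε₀ ∧ ∃ C : ℝ, 0 < C ∧ ∀ ε : ℝ, 0 < ε → ε ≤ ε₀ →
        ENNReal.ofReal (C * ε ^ (-(p - 1))) ≤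
          QuasilinearWave.lifespan U c (fun x => ε * φ x) (fun x => ε * ψ x)) ∧
    (ContDiffOn ℝ 1 c U → deriv c 0 ≠ 0 →
      ∃ ε₀ : ℝ, 0 < ε₀ ∧ ∃ C : ℝ, 0 < C ∧ ∀ ε : ℝ, 0 < ε → ε ≤ ε₀ →
        ENNReal.ofReal (C * ε⁻¹) ≤
          QuasilinearWave.lifespan U c (fun x => ε * φ x) (fun x => ε * ψ x)) := by
  have hU0 := hU.mem_nhds h0U
  refine ⟨fun p hp hflat => ?_, fun hc _ => ?_⟩
  · simpa only [show p - 2 + 1 = p - 1 by ring] using theorem1_general hU0 hc0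
      (hflat.contDiffAt hp hU0) hφ hψ (sub_pos.2 hp).le (hflat.isBigO_deriv hp hU0)
  · have hcont : ContinuousAt (deriv c) 0 :=
      ((hc.contDiffAt hU0).derivWithin (m := 0) le_rfl).continuousAt
    simpa only [zero_add, Real.rpow_neg_one] using theorem1_general hU0 hc0 (hc.contDiffAt hU0) hφ
      hψ le_rfl (by simpa only [Real.rpow_zero] using hcont.isBigO_one ℝ)
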